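/- Let $p$ be a prime, let $m \ge 2$ be an integer, and let $\delta>0$, $\nu>0$, $\epsilon>0$. Then there exists a constant $c = c(\delta,\nu,\epsilon,p,m)>0$ such that the following holds for all positive integers $n$ and $s$. If $\mathcal{A}_1,\dots,\mathcal{A}_s$ are non-empty subsets of $\{0,1\}^n$, each of density $|\mathcal{A}_i|/2^n \ge \delta$, then there exists a subset $Q \subset [s]$ with $|Q| \ge c\,s$ such that for at least $(1-\epsilon)|Q|^m$ of the $m$-tuples $(i_1,\dots,i_m)\in Q^m$ we have, simultaneously for every linear form $\phi:\mathbb{F}_p^n\to\mathbb{F}_p$, \[\omega_{\mathcal{A}_{i_1},\dots,\mathcal{A}_{i_m}}(\phi) \ge 2^{-(m+1)(p-1)}-\nu.\] Here $\{0,1\}^n$ is viewed as a subset of $\mathbb{F}_p^n$, and for non-empty $\mathcal{B}_1,\dots,\mathcal{B}_m\subset\{0,1\}^n$ the overlap is \[\omega_{\mathcal{B}_1,\dots,\mathcal{B}_m}(\phi)=\sum_{d\in\mathbb{F}_p}\min_{1\le t\le m}\mathbb{P}_{x\in\mathcal{B}_t}[\phi(x)=d],\] where $x$ is chosen uniformly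 at random in $\mathcal{B}_t$. -/

import Mathlib

namespace ModPForms

/-- The Boolean cube `{0,1}^n`. -/
abbrev Cube (n : ℕ) : Type := Fin n → Bool

/-- The inclusion of `{0,1}^n` into `𝔽_p^n`. -/
def Cube.toZMod (p : ℕ) {n : ℕ} (x : Cube n) : Fin n → ZMod p :=
  fun z => if x z then 1 else 0

/-- A mod-`p` form in `n` variables: a linear form `𝔽_p^n → 𝔽_p`. -/
abbrev ModPForm (p n : ℕ) : Type := (Fin n → ZMod p) →ₗ[ZMod p] ZMod p

/-- The density of `A` inside `{0,1}^n`. -/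
noncomputable def density {n : ℕ} (A : Finset (Cube n)) : ℝ :=
  (A.card : ℝ) / 2 ^ n

/-- The distribution of `F(x)` for `x` chosen uniformly at random in `A` (for non-empty `A`):
`distr A F d` is the probability that `F(x) = d`. -/
noncomputable def distr {n : ℕ} {D : Type*} [DecidableEq D] (A : Finset (Cube n))
    (F : Cube n → D) (d : D) : ℝ :=
  ((A.filter fun x => F x = d).card : ℝ) / A.card

/-- The overlap of an `m`-tuple of distributions on a finite set `D`, given by their probability
mass functions: `∑ d ∈ D, min (X 1 d, …, X m d)`. For `m ≥ 1` the infimum is a minimum over a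
non-empty finite set. -/
noncomputable def overlap {m : ℕ} {D : Type*} [Fintype D] (X : Fin m → D → ℝ) : ℝ :=
  ∑ d : D, ⨅ t : Fin m, X t d

/-- The overlap of the distributions of the mod-`p` form `φ` on the subsets `A 1, …, A m` of
`{0,1}^n`. -/
noncomputable def formOverlap {p n m : ℕ} [NeZero p] (A : Fin m → Finset (Cube n))
    (φ : ModPForm p n) : ℝ :=
  overlap fun t => distr (A t) fun x => φ (x.toZMod p)

end ModPForms

/-! Small overlap can only come from structure shared by two of the sets. Call a form structured on
`A` if a non-zero multiple of it has a large Fourier coefficient on `A`; a form that is not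
structured on `A` is nearly uniform there. If `φ` is structured on at most one set of a tuple, a
most popular value of `φ` on that set already gives overlap about `1 / p`.

Exponential sums over the cube decay geometrically in the Hamming weight of the form, so almost
orthogonality (`card_le_of_almost_orthogonal`) places the forms with a large coefficient on a dense
set in boundedly many Hamming balls. It also leaves only boundedly many Walsh functions that
correlate with a given form on that set. Shared structure is recorded in a bounded pair `(V, Z)` of
forms and coordinates. While many pairs of sets share something further, one set linked to many
others offers boundedly many extensions of `(V, Z)`, and pigeonholing keeps a positive proportion of
the family. Since `(V, Z)` cannot grow forever, `exists_stable_subset` reaches a family in which few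
pairs are linked.

Take an unlinked tuple and a form `φ` structured on two of its sets. Then `φ = a • v + χ` with `v ∈
V` and `χ` of bounded support, and the sets `W t` of structured coordinates meet pairwise only
inside `Z`. Let `d₀` be the popular value, common to all sets, of `a • v` plus the `Z`-part of `χ`,
and `c t` a popular value of the `W t \ Z`-part of `χ` given `d₀`. The target value is `d₀ + ∑ c s`.
On `A t` the two popular events hold together with probability at least `p⁻²`. The rest of `χ` is
nearly independent of them and must equal the sum of the other `c s`; this value is attained because
the private blocks are disjoint, hence it has probability at least `2 ^ (-(p - 1))` on the cube
(`two_pow_le_card_fiber`). With `p ≤ 2 ^ (p - 1)` the product is at least `2 ^ (-3 (p - 1))`, which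
suffices for `m ≥ 2`. -/

namespace ModPForms

open Finset

/-! ### Iterated refinement -/

-- Energy-increment scheme in abstract form: `rank` is a bounded potential, `bad` marks pairs that
-- force a larger state, and `same` is a finite colouring made uniform before each test.
open Classical in
theorem exists_stable_subset (K L N : ℕ) (ε : ℝ) (hε : 0 < ε) :
    ∃ c : ℝ, 0 < c ∧ ∀ {ι St : Type} (rank : St → ℕ) (Inv : St → ι → Prop)
      (bad same : St → ι → ι → Prop),
      (∀ st j, Inv st j → rank st ≤ N) →
      (∀ st j, Inv st j → ∃ κ : ι → ℕ, (∀ i, κ i < K) ∧ ∀ i j, κ i = κ j → same st i j) →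
      (∀ st i, Inv st i → ∃ O : Finset St, O.card ≤ L ∧ (∀ st' ∈ O, rank st' = rank st + 1) ∧
        ∀ j, Inv st j → bad st i j → ∃ st' ∈ O, Inv st' j) →
      ∀ st₀ (Q₀ : Finset ι), Q₀.Nonempty → (∀ j ∈ Q₀, Inv st₀ j) →
        ∃ st, ∃ Q : Finset ι, c * (Q₀.card : ℝ) ≤ Q.card ∧ (∀ j ∈ Q, Inv st j) ∧
          (∀ i ∈ Q, ∀ j ∈ Q, same st i j) ∧
          (((Q ×ˢ Q).filter fun q => bad st q.1 q.2).card : ℝ) ≤ ε * (Q.card : ℝ) ^ 2 := by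
  -- Induction on the number `k` of ranks still available; at `k = 0` the rank would exceed `N`,
  -- which no state satisfying the invariant allows.
  suffices H : ∀ k : ℕ, ∃ c : ℝ, 0 < c ∧ ∀ {ι St : Type} (rank : St → ℕ) (Inv : St → ι → Prop)
      (bad same : St → ι → ι → Prop),
      (∀ st j, Inv st j → rank st ≤ N) →
      (∀ st j, Inv st j → ∃ κ : ι → ℕ, (∀ i, κ i < K) ∧ ∀ i j, κ i = κ j → same st i j) →
      (∀ st i, Inv st i → ∃ O : Finset St, O.card ≤ L ∧ (∀ st' ∈ O, rank st' = rank st + 1) ∧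
        ∀ j, Inv st j → bad st i j → ∃ st' ∈ O, Inv st' j) →
      ∀ st₀ (Q₀ : Finset ι), N + 1 ≤ rank st₀ + k → Q₀.Nonempty → (∀ j ∈ Q₀, Inv st₀ j) →
        ∃ st, ∃ Q : Finset ι, c * (Q₀.card : ℝ) ≤ Q.card ∧ (∀ j ∈ Q, Inv st j) ∧
          (∀ i ∈ Q, ∀ j ∈ Q, same st i j) ∧
          (((Q ×ˢ Q).filter fun q => bad st q.1 q.2).card : ℝ) ≤ ε * (Q.card : ℝ) ^ 2 by
    obtain ⟨c, hc, h⟩ := H (N + 1)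
    exact ⟨c, hc, fun rank Inv bad same h1 h2 h3 st₀ Q₀ =>
      h rank Inv bad same h1 h2 h3 st₀ Q₀ (by omega)⟩
  intro k
  induction k with
  | zero =>
    refine ⟨1, one_pos, fun rank Inv bad same h1 _ _ st₀ Q₀ hN ⟨j, hj⟩ hQ => ?_⟩
    have := h1 st₀ j (hQ j hj)
    omega
  | succ k ih =>
    obtain ⟨c, hc, ih⟩ := ih
    -- The first entry pays for stopping inside one colour class. The second pays for a full round:
    -- a colour class, the bad partners of one `i` (proportion `ε`), and one of at most `L`
    -- successor states.
    refine ⟨min (1 / (K + 1)) (c * (ε / ((K + 1) * (L + 1)))), by positivity, ?_⟩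
    intro ι St rank Inv bad same h1 h2 h3 st₀ Q₀ hN hQ₀ hInv
    obtain ⟨j₀, hj₀⟩ := hQ₀
    obtain ⟨κ, hκ, hsame⟩ := h2 st₀ j₀ (hInv j₀ hj₀)
    have hQ₀pos : (0 : ℝ) < Q₀.card := by exact_mod_cast card_pos.mpr ⟨j₀, hj₀⟩
    obtain ⟨y, -, hy⟩ := exists_le_card_fiber_of_nsmul_le_card_of_maps_to
      (s := Q₀) (t := range (K + 1)) (f := κ) (b := (Q₀.card : ℝ) / (K + 1))
      (fun i _ => mem_range.mpr ((hκ i).trans (Nat.lt_succ_self K))) ⟨0, by simp⟩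
      (by rw [nsmul_eq_mul, card_range]; push_cast; exact le_of_eq (by field_simp))
    set Q₁ := Q₀.filter fun i => κ i = y with hQ₁
    have hsub : ∀ j ∈ Q₁, Inv st₀ j := fun j hj => hInv j (mem_filter.mp hj).1
    have hQ₁pos : (0 : ℝ) < Q₁.card := lt_of_lt_of_le (by positivity) hy
    by_cases hbad : (((Q₁ ×ˢ Q₁).filter fun q => bad st₀ q.1 q.2).card : ℝ) ≤
        ε * (Q₁.card : ℝ) ^ 2
    · refine ⟨st₀, Q₁, ?_, hsub, ?_, hbad⟩
      · refine le_trans ?_ hy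
        calc _ ≤ 1 / ((K : ℝ) + 1) * Q₀.card := by gcongr; exact min_le_left _ _
          _ = _ := by ring
      · intro i hi j hj
        exact hsame i j ((mem_filter.mp hi).2.trans (mem_filter.mp hj).2.symm)
    have hi : ∃ i ∈ Q₁, ε * Q₁.card < ((Q₁.filter fun j => bad st₀ i j).card : ℝ) := by
      by_contra! hcon
      apply hbad
      have : ((Q₁ ×ˢ Q₁).filter fun q => bad st₀ q.1 q.2).card =
          ∑ i ∈ Q₁, (Q₁.filter fun j => bad st₀ i j).card := by
        simp only [card_filter, sum_product]
      rw [this]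
      push_cast
      calc _ ≤ ∑ _i ∈ Q₁, ε * (Q₁.card : ℝ) := sum_le_sum hcon
        _ = _ := by rw [sum_const, nsmul_eq_mul]; ring
    obtain ⟨i, hi, hiB⟩ := hi
    set B := Q₁.filter fun j => bad st₀ i j with hB
    obtain ⟨O, hOL, hOrank, hO⟩ := h3 st₀ i (hsub i hi)
    have hO' : ∀ j ∈ B, ∃ st' ∈ O, Inv st' j := fun j hj =>
      hO j (hsub j (mem_filter.mp hj).1) (mem_filter.mp hj).2
    have hBpos : (0 : ℝ) < B.card := lt_trans (by positivity) hiB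
    obtain ⟨j₁, hj₁⟩ := card_pos.mp (by exact_mod_cast hBpos : 0 < B.card)
    obtain ⟨st₁, hst₁, -⟩ := hO' j₁ hj₁
    let f : ι → St := fun j => if h : ∃ st' ∈ O, Inv st' j then h.choose else st₁
    have hf : ∀ j ∈ B, f j ∈ O ∧ Inv (f j) j := fun j hj => by
      have h := hO' j hj
      simp only [f, dif_pos h]
      exact h.choose_spec
    have hOpos : (0 : ℝ) < O.card := by exact_mod_cast card_pos.mpr ⟨st₁, hst₁⟩
    obtain ⟨st', hst', hcard⟩ := exists_le_card_fiber_of_nsmul_le_card_of_maps_to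
      (s := B) (t := O) (f := f) (b := (B.card : ℝ) / O.card)
      (fun j hj => (hf j hj).1) ⟨st₁, hst₁⟩
      (by rw [nsmul_eq_mul]; exact le_of_eq (by field_simp))
    have hQ₂pos : (0 : ℝ) < (B.filter fun j => f j = st').card :=
      lt_of_lt_of_le (by positivity) hcard
    obtain ⟨st, Q, hQ, hQ'⟩ := ih rank Inv bad same h1 h2 h3 st' (B.filter fun j => f j = st')
      (by rw [hOrank st' hst']; omega) (card_pos.mp (by exact_mod_cast hQ₂pos))
      (fun j hj => by
        have := (hf j (mem_filter.mp hj).1).2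
        rwa [(mem_filter.mp hj).2] at this)
    refine ⟨st, Q, le_trans ?_ hQ, hQ'⟩
    have hOL' : (O.card : ℝ) ≤ L + 1 := by
      have : (O.card : ℝ) ≤ L := by exact_mod_cast hOL
      linarith
    calc _ ≤ c * (ε / ((K + 1) * (L + 1))) * (Q₀.card : ℝ) := by gcongr; exact min_le_right _ _
      _ = c * (ε * (Q₀.card / (K + 1)) / (L + 1)) := by field_simp
      _ ≤ c * (ε * Q₁.card / (L + 1)) := by gcongr
      _ ≤ c * (B.card / O.card) := by gcongr
      _ ≤ _ := by gcongr

-- Union bound over the `m ^ 2` ordered pairs of positions.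
open Classical in
theorem card_tuples_no_bad_pair {ι : Type*} [Fintype ι] (m : ℕ) (bad : ι → ι → Prop)
    (Q : Finset ι) (ε : ℝ)
    (hbad : (((Q ×ˢ Q).filter fun q => bad q.1 q.2).card : ℝ) ≤ ε * (Q.card : ℝ) ^ 2) :
    (1 - m ^ 2 * ε) * (Q.card : ℝ) ^ m ≤ ((Fintype.piFinset fun _ : Fin m => Q).filter
      fun i => ∀ t t', t ≠ t' → ¬ bad (i t) (i t')).card := by
  set P := Fintype.piFinset fun _ : Fin m => Q with hP
  have hPcard : P.card = Q.card ^ m := by simp [hP]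
  have hpair : ∀ q : Fin m × Fin m,
      ((P.filter fun i => q.1 ≠ q.2 ∧ bad (i q.1) (i q.2)).card : ℝ) ≤ ε * (Q.card : ℝ) ^ m := by
    rintro ⟨t, t'⟩
    by_cases htt : t = t'
    -- The filter is empty here, so only non-negativity is needed. The sign of `ε` follows from
    -- `hbad` when `Q` is non-empty; otherwise the power vanishes.
    · have : 0 ≤ ε * (Q.card : ℝ) ^ m := by
        rcases eq_or_ne Q.card 0 with h | h
        · have hm : m ≠ 0 := by
            have := t.pos
            omega
          simp [h, hm]
        · have hpos : (0 : ℝ) < Q.card := by exact_mod_cast Nat.pos_of_ne_zero h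
          have : 0 ≤ ε := by
            by_contra! hneg
            have h1 : ε * (Q.card : ℝ) ^ 2 < 0 := mul_neg_of_neg_of_pos hneg (by positivity)
            have h2 : (0 : ℝ) ≤ ((Q ×ˢ Q).filter fun q => bad q.1 q.2).card := by positivity
            linarith
          positivity
      simpa [htt] using this
    · have hm : Fintype.card {u : Fin m // u ≠ t ∧ u ≠ t'} + 2 = m := by
        have h1 : Fintype.card {u : Fin m // u ≠ t ∧ u ≠ t'} = (univ \ {t, t'} : Finset (Fin m)).card := by
          rw [Fintype.card_subtype]
          congr 1
          ext u
          simp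
        have h2 := card_sdiff_add_card_eq_card (subset_univ ({t, t'} : Finset (Fin m)))
        rw [card_pair htt, card_univ, Fintype.card_fin] at h2
        omega
      have hle : (P.filter fun i => t ≠ t' ∧ bad (i t) (i t')).card ≤
          (((Q ×ˢ Q).filter fun q => bad q.1 q.2) ×ˢ
            Fintype.piFinset fun _ : {u : Fin m // u ≠ t ∧ u ≠ t'} => Q).card := by
        refine card_le_card_of_injOn (fun i => ((i t, i t'), fun u => i u.1)) ?_ ?_
        · intro i hi
          simp only [hP, coe_filter, Fintype.mem_piFinset, Set.mem_ofPred_eq] at hi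
          simp [hi.1, hi.2.2]
        · intro i _ i' _ h
          simp only [Prod.mk.injEq] at h
          funext u
          by_cases h1 : u = t
          · rw [h1]; exact h.1.1
          by_cases h2 : u = t'
          · rw [h2]; exact h.1.2
          exact congrFun h.2 ⟨u, h1, h2⟩
      rw [card_product] at hle
      simp only [Fintype.card_piFinset, prod_const, card_univ] at hle
      calc _ ≤ (((Q ×ˢ Q).filter fun q => bad q.1 q.2).card : ℝ) *
            (Q.card : ℝ) ^ Fintype.card {u : Fin m // u ≠ t ∧ u ≠ t'} := by exact_mod_cast hle
        _ ≤ ε * (Q.card : ℝ) ^ 2 *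
            (Q.card : ℝ) ^ Fintype.card {u : Fin m // u ≠ t ∧ u ≠ t'} := by gcongr
        _ = ε * (Q.card : ℝ) ^ m := by rw [mul_assoc, ← pow_add, add_comm 2, hm]
  have hcover : P ⊆ (P.filter fun i => ∀ t t', t ≠ t' → ¬ bad (i t) (i t')) ∪
      (univ : Finset (Fin m × Fin m)).biUnion
        fun q => P.filter fun i => q.1 ≠ q.2 ∧ bad (i q.1) (i q.2) := by
    intro i hi
    by_cases h : ∀ t t', t ≠ t' → ¬ bad (i t) (i t')
    · exact mem_union_left _ (mem_filter.mpr ⟨hi, h⟩)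
    · push Not at h
      obtain ⟨t, t', h1, h2⟩ := h
      exact mem_union_right _ (mem_biUnion.mpr ⟨(t, t'), mem_univ _, mem_filter.mpr ⟨hi, h1, h2⟩⟩)
  have h1 := (card_le_card hcover).trans (card_union_le _ _)
  have h2 : (((univ : Finset (Fin m × Fin m)).biUnion
      fun q => P.filter fun i => q.1 ≠ q.2 ∧ bad (i q.1) (i q.2)).card : ℝ) ≤
      m ^ 2 * ε * (Q.card : ℝ) ^ m := by
    calc _ ≤ ((∑ q : Fin m × Fin m,
          (P.filter fun i => q.1 ≠ q.2 ∧ bad (i q.1) (i q.2)).card : ℕ) : ℝ) := by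
          exact_mod_cast card_biUnion_le
      _ ≤ ∑ _q : Fin m × Fin m, ε * (Q.card : ℝ) ^ m := by
          push_cast
          exact sum_le_sum fun q _ => hpair q
      _ = _ := by simp; ring
  rw [hPcard] at h1
  have h3 := (Nat.cast_le (α := ℝ)).mpr h1
  push_cast at h3
  linarith

/-! ### Linear forms on the cube -/

section Fibers

variable {p : ℕ} {n : ℕ}

theorem dotProduct_toZMod (φ : Fin n → ZMod p) (x : Cube n) :
    φ ⬝ᵥ x.toZMod p = ∑ z, if x z then φ z else 0 := by
  simp [dotProduct, Cube.toZMod]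

/-- Flipping coordinate `z` of `y` changes the value by `c z`. Two of the `n + 1 > p` prefix sums of
`c` coincide, and flipping the interval between them changes nothing in total. -/
theorem exists_ne_dotProduct_eq [NeZero p] (hn : p ≤ n) (φ : Fin n → ZMod p) (y : Cube n) :
    ∃ y' : Cube n, y' ≠ y ∧ φ ⬝ᵥ y'.toZMod p = φ ⬝ᵥ y.toZMod p := by
  set c : Fin n → ZMod p := fun z => if y z then -φ z else φ z with hc
  obtain ⟨i, j, hij, hs⟩ : ∃ i j : Fin (n + 1), i < j ∧
      (∑ z : Fin n, if (z : ℕ) < i then c z else 0) =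
        ∑ z : Fin n, if (z : ℕ) < j then c z else 0 := by
    obtain ⟨i, j, hne, h⟩ := Fintype.exists_ne_map_eq_of_card_lt
      (fun k : Fin (n + 1) => ∑ z : Fin n, if (z : ℕ) < k then c z else 0)
      (by rw [ZMod.card, Fintype.card_fin]; omega)
    rcases lt_or_gt_of_ne hne with h' | h'
    · exact ⟨i, j, h', h⟩
    · exact ⟨j, i, h', h.symm⟩
  have hij' : (i : ℕ) < j := hij
  refine ⟨fun z => if (i : ℕ) ≤ z ∧ (z : ℕ) < j then !(y z) else y z, ?_, ?_⟩
  · intro h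
    have := congrFun h ⟨i, by omega⟩
    simp [hij'] at this
  · rw [← sub_eq_zero] at hs ⊢
    rw [← neg_eq_zero, ← hs, dotProduct_toZMod, dotProduct_toZMod, ← sum_sub_distrib,
      ← sum_sub_distrib, ← sum_neg_distrib]
    refine sum_congr rfl fun z _ => ?_
    simp only [hc]
    by_cases h1 : (i : ℕ) ≤ z <;> by_cases h2 : (z : ℕ) < j <;> by_cases h3 : y z <;>
      by_cases h4 : (z : ℕ) < i <;> simp [h1, h2, h3, h4] <;> omega

theorem dotProduct_insertNth {k : ℕ} (φ : Fin (k + 1) → ZMod p) (z : Fin (k + 1)) (b : Bool)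
    (w : Cube k) : φ ⬝ᵥ Cube.toZMod p (z.insertNth b w : Cube (k + 1)) =
      (if b then φ z else 0) + (fun i => φ (z.succAbove i)) ⬝ᵥ w.toZMod p := by
  rw [dotProduct_toZMod, dotProduct_toZMod, Fin.sum_univ_succAbove _ z]
  simp

/-- A value attained by a mod-`p` form on the cube is attained with probability at least
`2 ^ (-(p - 1))`. -/
theorem two_pow_le_card_fiber [NeZero p] (n : ℕ) (φ : Fin n → ZMod p) (e : ZMod p) (y : Cube n)
    (hy : φ ⬝ᵥ y.toZMod p = e) :
    2 ^ n ≤ (univ.filter fun x : Cube n => φ ⬝ᵥ x.toZMod p = e).card * 2 ^ (p - 1) := by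
  induction n generalizing e with
  | zero =>
    have : 0 < (univ.filter fun x : Cube 0 => φ ⬝ᵥ x.toZMod p = e).card :=
      card_pos.mpr ⟨y, mem_filter.mpr ⟨mem_univ _, hy⟩⟩
    exact Nat.mul_pos this (by positivity)
  | succ k ih =>
    -- In dimension below `p` a single point is dense enough. Otherwise two points of the fibre
    -- differ at some `z`, so both half-cubes at `z` meet the fibre and induction applies to each
    -- without loss.
    by_cases hk : k + 1 ≤ p - 1
    · have : 0 < (univ.filter fun x : Cube (k + 1) => φ ⬝ᵥ x.toZMod p = e).card :=
        card_pos.mpr ⟨y, mem_filter.mpr ⟨mem_univ _, hy⟩⟩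
      calc 2 ^ (k + 1) ≤ 2 ^ (p - 1) := Nat.pow_le_pow_right (by norm_num) hk
        _ ≤ _ := Nat.le_mul_of_pos_left _ this
    · obtain ⟨y', hne, hy'⟩ := exists_ne_dotProduct_eq (by omega : p ≤ k + 1) φ y
      obtain ⟨z, hz⟩ := Function.ne_iff.mp hne
      have key : ∀ v : Cube (k + 1), φ ⬝ᵥ v.toZMod p = e → 2 ^ k ≤
          (univ.filter fun x : Cube (k + 1) => φ ⬝ᵥ x.toZMod p = e ∧ x z = v z).card *
            2 ^ (p - 1) := by
        intro v hv
        have hv' := dotProduct_insertNth φ z (v z) (fun i => v (z.succAbove i))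
        have hins : (z.insertNth (v z) (fun i => v (z.succAbove i)) : Cube (k + 1)) = v :=
          Fin.insertNth_self_removeNth z v
        rw [hins, hv] at hv'
        refine (ih (fun i => φ (z.succAbove i)) (e - if v z then φ z else 0)
          (fun i => v (z.succAbove i)) (by rw [hv']; ring)).trans ?_
        refine Nat.mul_le_mul_right _ (card_le_card_of_injOn
          (fun w => (z.insertNth (v z) w : Cube (k + 1))) ?_ ?_)
        · intro w hw
          have hw' := (mem_filter.mp (mem_coe.mp hw)).2
          have := dotProduct_insertNth φ z (v z) w
          rw [hw'] at this
          simp [this]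
        · intro w _ w' _ h
          exact Fin.insertNth_right_injective (α := fun _ => Bool) (p := z) (v z) h
      have hdisj : Disjoint
          (univ.filter fun x : Cube (k + 1) => φ ⬝ᵥ x.toZMod p = e ∧ x z = y z)
          (univ.filter fun x : Cube (k + 1) => φ ⬝ᵥ x.toZMod p = e ∧ x z = y' z) := by
        rw [disjoint_filter]
        rintro x - ⟨-, h1⟩ ⟨-, h2⟩
        exact hz (h2.symm.trans h1)
      have hsub : (univ.filter fun x : Cube (k + 1) => φ ⬝ᵥ x.toZMod p = e ∧ x z = y z) ∪
          (univ.filter fun x : Cube (k + 1) => φ ⬝ᵥ x.toZMod p = e ∧ x z = y' z) ⊆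
          univ.filter fun x : Cube (k + 1) => φ ⬝ᵥ x.toZMod p = e := by
        intro x hx
        simp only [mem_union, mem_filter, mem_univ, true_and] at hx ⊢
        tauto
      have h1 := card_le_card hsub
      rw [card_union_of_disjoint hdisj] at h1
      have h2 := key y hy
      have h3 := key y' (hy'.trans hy)
      calc 2 ^ (k + 1) = 2 ^ k + 2 ^ k := by ring
        _ ≤ _ := Nat.add_le_add h2 h3
        _ = _ := (add_mul _ _ _).symm
        _ ≤ _ := Nat.mul_le_mul_right _ h1

end Fibers

/-! ### Almost orthogonal families -/

/-- Duality: rotate the `u k` by phases so that their sums over `A` add up, apply Cauchy–Schwarz on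
`A`, enlarge `A` to `X`, and expand the square into diagonal and off-diagonal terms. -/
theorem card_le_of_almost_orthogonal {X ι : Type*} [Fintype X] (A : Finset X)
    (K : Finset ι) (u : ι → X → ℂ) {δ η κ : ℝ} (hδ : 0 < δ) (hη : 0 ≤ η) (hX : 0 < Fintype.card X)
    (hA : δ * Fintype.card X ≤ A.card) (hu : ∀ k ∈ K, ∀ x, ‖u k x‖ ≤ 1)
    (hη' : ∀ k ∈ K, η * A.card ≤ ‖∑ x ∈ A, u k x‖)
    (hκ0 : 0 ≤ κ)
    (hκ : ∀ k ∈ K, ∀ l ∈ K, k ≠ l →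
      ‖∑ x, u k x * (starRingEnd ℂ) (u l x)‖ ≤ κ * Fintype.card X) :
    (K.card : ℝ) * (η ^ 2 * δ - κ) ≤ 1 := by
  classical
  rcases K.eq_empty_or_nonempty with rfl | hK
  · simp
  have hKpos : (0 : ℝ) < K.card := by exact_mod_cast card_pos.mpr hK
  have hXpos : (0 : ℝ) < Fintype.card X := by exact_mod_cast hX
  have hApos : (0 : ℝ) < A.card := lt_of_lt_of_le (by positivity) hA
  have hc : ∀ k, ∃ c : ℂ, ‖c‖ ≤ 1 ∧ c * ∑ x ∈ A, u k x = ‖∑ x ∈ A, u k x‖ := by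
    intro k
    by_cases h : ∑ x ∈ A, u k x = 0
    · exact ⟨0, by simp, by simp [h]⟩
    · have h' : (‖∑ x ∈ A, u k x‖ : ℂ) ≠ 0 := by simpa using h
      refine ⟨‖∑ x ∈ A, u k x‖ / ∑ x ∈ A, u k x, ?_, by field_simp⟩
      rw [norm_div, Complex.norm_real, norm_norm, div_self (by simpa using h)]
  choose c hc1 hc2 using hc
  set F : X → ℂ := fun x => ∑ k ∈ K, c k * u k x with hF
  have h1 : η * K.card * A.card ≤ ∑ x ∈ A, ‖F x‖ := by
    calc η * K.card * A.card = ∑ _k ∈ K, η * A.card := by rw [sum_const, nsmul_eq_mul]; ring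
      _ ≤ ∑ k ∈ K, ‖∑ x ∈ A, u k x‖ := sum_le_sum hη'
      _ = ‖((∑ k ∈ K, ‖∑ x ∈ A, u k x‖ : ℝ) : ℂ)‖ := by
          rw [Complex.norm_real, Real.norm_of_nonneg (sum_nonneg fun _ _ => norm_nonneg _)]
      _ = ‖∑ x ∈ A, F x‖ := by
          congr 1
          push_cast
          simp only [hF]
          rw [sum_comm]
          refine sum_congr rfl fun k _ => ?_
          rw [← mul_sum, hc2]
      _ ≤ _ := norm_sum_le _ _
  have h2 : (∑ x ∈ A, ‖F x‖) ^ 2 ≤ A.card * ∑ x, ‖F x‖ ^ 2 :=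
    (sq_sum_le_card_mul_sum_sq).trans
      (mul_le_mul_of_nonneg_left
        (sum_le_sum_of_subset_of_nonneg (subset_univ _) fun _ _ _ => by positivity) hApos.le)
  have h3 : ∑ x, ‖F x‖ ^ 2 ≤ (K.card + K.card ^ 2 * κ) * Fintype.card X := by
    have e1 : ((∑ x, ‖F x‖ ^ 2 : ℝ) : ℂ) = ∑ k ∈ K, ∑ l ∈ K, c k * (starRingEnd ℂ) (c l) *
        ∑ x, u k x * (starRingEnd ℂ) (u l x) := by
      push_cast
      simp_rw [← Complex.mul_conj', hF, map_sum, sum_mul_sum, map_mul, mul_sum]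
      rw [sum_comm]
      refine sum_congr rfl fun k _ => ?_
      rw [sum_comm]
      refine sum_congr rfl fun l _ => sum_congr rfl fun x _ => by ring
    calc ∑ x, ‖F x‖ ^ 2 = ‖((∑ x, ‖F x‖ ^ 2 : ℝ) : ℂ)‖ := by
          rw [Complex.norm_real, Real.norm_of_nonneg (sum_nonneg fun _ _ => by positivity)]
      _ ≤ ∑ k ∈ K, ∑ l ∈ K, ((if k = l then (1 : ℝ) else 0) + κ) * Fintype.card X := by
          rw [e1]
          refine (norm_sum_le _ _).trans (sum_le_sum fun k hk => (norm_sum_le _ _).trans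
            (sum_le_sum fun l hl => ?_))
          rw [norm_mul, norm_mul, RCLike.norm_conj]
          have hcc : ‖c k‖ * ‖c l‖ ≤ 1 := mul_le_one₀ (hc1 k) (norm_nonneg _) (hc1 l)
          refine (mul_le_of_le_one_left (norm_nonneg _) hcc).trans ?_
          split_ifs with hkl
          · subst hkl
            refine (norm_sum_le _ _).trans ?_
            calc _ ≤ ∑ _x : X, (1 : ℝ) := sum_le_sum fun x _ => by
                  rw [norm_mul, RCLike.norm_conj]
                  exact mul_le_one₀ (hu k hk x) (norm_nonneg _) (hu k hk x)
              _ = Fintype.card X := by simp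
              _ ≤ _ := le_mul_of_one_le_left hXpos.le (by linarith)
          · simpa using hκ k hk l hl hkl
      _ = _ := by
          simp_rw [← sum_mul, sum_add_distrib]
          simp
          left
          ring
  have h4 : (η * K.card * A.card) ^ 2 ≤ A.card * ((K.card + K.card ^ 2 * κ) * Fintype.card X) :=
    ((pow_le_pow_left₀ (by positivity) h1 2).trans h2).trans (by gcongr)
  have h5 : η ^ 2 * K.card ^ 2 * A.card ≤ (K.card + K.card ^ 2 * κ) * Fintype.card X := by
    refine le_of_mul_le_mul_left ?_ hApos
    calc _ = (η * K.card * A.card) ^ 2 := by ring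
      _ ≤ _ := h4
  have h6 : η ^ 2 * K.card ^ 2 * δ ≤ K.card + K.card ^ 2 * κ := by
    refine le_of_mul_le_mul_right ?_ hXpos
    calc _ = η ^ 2 * K.card ^ 2 * (δ * Fintype.card X) := by ring
      _ ≤ η ^ 2 * K.card ^ 2 * A.card := by gcongr
      _ ≤ _ := h5
  refine le_of_mul_le_mul_left ?_ hKpos
  linarith

/-! ### Characters and Walsh functions on the cube -/

section Fourier

variable {n : ℕ}

theorem sum_cube_prod {R : Type*} [CommSemiring R] (g : Fin n → Bool → R) :
    ∑ x : Cube n, ∏ z, g z (x z) = ∏ z, (g z true + g z false) := by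
  have := prod_univ_sum (fun _ : Fin n => (univ : Finset Bool)) g
  rw [Fintype.piFinset_univ] at this
  rw [← this]
  simp

/-- The Walsh function of the coordinates in `T`. -/
noncomputable def walsh (T : Finset (Fin n)) (x : Cube n) : ℂ :=
  ∏ z ∈ T, if x z then -1 else 1

theorem walsh_eq_prod (T : Finset (Fin n)) (x : Cube n) :
    walsh T x = ∏ z, if z ∈ T then (if x z then -1 else 1) else 1 := by
  simp [walsh]

theorem norm_walsh (T : Finset (Fin n)) (x : Cube n) : ‖walsh T x‖ = 1 := by
  rw [walsh, norm_prod]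
  exact prod_eq_one fun z _ => by split_ifs <;> simp

theorem conj_walsh (T : Finset (Fin n)) (x : Cube n) :
    (starRingEnd ℂ) (walsh T x) = walsh T x := by
  rw [walsh, map_prod]
  exact prod_congr rfl fun z _ => by split_ifs <;> simp

theorem walsh_union {T U : Finset (Fin n)} (h : Disjoint T U) (x : Cube n) :
    walsh (T ∪ U) x = walsh T x * walsh U x := prod_union h

theorem sum_walsh_mul_walsh {T U : Finset (Fin n)} (h : T ≠ U) :
    ∑ x, walsh T x * walsh U x = 0 := by
  obtain ⟨z, hz⟩ : ∃ z, ¬ (z ∈ T ↔ z ∈ U) := by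
    by_contra! hcon
    exact h (Finset.ext hcon)
  simp_rw [walsh_eq_prod, ← prod_mul_distrib]
  rw [sum_cube_prod fun z b => (if z ∈ T then (if b then (-1 : ℂ) else 1) else 1) *
    (if z ∈ U then (if b then (-1 : ℂ) else 1) else 1)]
  refine prod_eq_zero (mem_univ z) ?_
  by_cases h1 : z ∈ T <;> by_cases h2 : z ∈ U <;> simp [h1, h2] at hz ⊢

theorem sum_walsh {T : Finset (Fin n)} (h : T.Nonempty) : ∑ x, walsh T x = 0 := by
  have := sum_walsh_mul_walsh (n := n) (T := T) (U := ∅) h.ne_empty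
  simpa [walsh] using this

/-- Normalised sums over the cube. -/
noncomputable def cubeMean (h : Cube n → ℂ) : ℂ := (∑ x, h x) / 2 ^ n

theorem norm_cubeMean_le {h : Cube n → ℂ} (hh : ∀ x, ‖h x‖ ≤ 1) : ‖cubeMean h‖ ≤ 1 := by
  rw [cubeMean, norm_div, norm_pow, Complex.norm_ofNat, div_le_one (by positivity)]
  refine (norm_sum_le _ _).trans ((sum_le_sum fun x _ => hh x).trans ?_)
  simp

/-- The kernel `∑ T ⊆ S, walsh T x * walsh T y` is a product over `S` that vanishes unless `x` and
`y` agree on `S`, where `h` takes equal values. -/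
theorem walsh_expansion (S : Finset (Fin n)) (h : Cube n → ℂ)
    (hS : ∀ x y, (∀ z ∈ S, x z = y z) → h x = h y) (x : Cube n) :
    h x = ∑ T ∈ S.powerset, cubeMean (fun y => h y * walsh T y) * walsh T x := by
  have key : ∀ y, h y * ∑ T ∈ S.powerset, walsh T x * walsh T y =
      h x * ∑ T ∈ S.powerset, walsh T x * walsh T y := by
    intro y
    by_cases hxy : ∀ z ∈ S, x z = y z
    · rw [hS x y hxy]
    · push Not at hxy
      obtain ⟨z, hz, hne⟩ := hxy
      have : ∑ T ∈ S.powerset, walsh T x * walsh T y = 0 := by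
        simp_rw [walsh, ← prod_mul_distrib]
        rw [← prod_one_add]
        refine prod_eq_zero hz ?_
        cases hx : x z <;> cases hy : y z <;> simp [hx, hy] at hne ⊢
      rw [this, mul_zero, mul_zero]
  have key2 : ∑ y, ∑ T ∈ S.powerset, walsh T x * walsh T y = 2 ^ n := by
    rw [sum_comm, sum_eq_single ∅]
    · simp [walsh]
    · intro T _ hT
      rw [← mul_sum, sum_walsh (nonempty_iff_ne_empty.mpr hT), mul_zero]
    · simp
  calc h x = (h x * ∑ y, ∑ T ∈ S.powerset, walsh T x * walsh T y) / 2 ^ n := by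
        rw [key2]; field_simp
    _ = (∑ y, h y * ∑ T ∈ S.powerset, walsh T x * walsh T y) / 2 ^ n := by
        rw [mul_sum]
        simp_rw [key]
    _ = _ := by
        simp_rw [mul_sum, cubeMean]
        rw [sum_comm, sum_div]
        refine sum_congr rfl fun T _ => ?_
        rw [div_mul_eq_mul_div, sum_mul]
        congr 1
        exact sum_congr rfl fun y _ => by ring

variable {p : ℕ} [NeZero p]

open ZMod

theorem norm_stdAddChar (a : ZMod p) : ‖(stdAddChar a : ℂ)‖ = 1 := by
  rw [stdAddChar_apply, Circle.norm_coe]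

theorem conj_stdAddChar (a : ZMod p) :
    (starRingEnd ℂ) (stdAddChar a : ℂ) = stdAddChar (-a) := by
  rw [AddChar.map_neg_eq_inv, Complex.inv_def, Complex.normSq_eq_norm_sq, norm_stdAddChar]
  simp

theorem stdAddChar_dotProduct (φ : Fin n → ZMod p) (x : Cube n) :
    (stdAddChar (φ ⬝ᵥ x.toZMod p) : ℂ) = ∏ z, if x z then (stdAddChar (φ z) : ℂ) else 1 := by
  rw [dotProduct_toZMod]
  refine (map_prod (stdAddChar (N := p)).toMonoidHom
    (fun z => Multiplicative.ofAdd (if x z then φ z else 0)) univ).trans ?_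
  exact prod_congr rfl fun z _ => by split_ifs <;> simp

theorem norm_one_add_lt {z : ℂ} (hz : ‖z‖ = 1) (hne : z ≠ 1) : ‖1 + z‖ < 2 := by
  have h1 : z.re ^ 2 + z.im ^ 2 = 1 := by
    have := Complex.sq_norm z
    rw [hz, Complex.normSq_apply] at this
    linarith
  have h2 : z.re < 1 := by
    by_contra! hre
    have him : z.im = 0 := by nlinarith
    have hre' : z.re = 1 := by nlinarith
    exact hne (Complex.ext hre' him)
  have h3 : ‖1 + z‖ ^ 2 < 2 ^ 2 := by
    rw [Complex.sq_norm, Complex.normSq_apply]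
    simp only [Complex.add_re, Complex.one_re, Complex.add_im, Complex.one_im, zero_add]
    nlinarith
  exact lt_of_pow_lt_pow_left₀ 2 (by norm_num) h3

theorem exists_stdAddChar_contraction (p : ℕ) [NeZero p] : ∃ γ : ℝ, 0 ≤ γ ∧ γ < 1 ∧
    ∀ a : ZMod p, a ≠ 0 → ‖1 + (stdAddChar a : ℂ)‖ ≤ 2 * γ := by
  have hlt : ∀ a : ZMod p, a ≠ 0 → ‖1 + (stdAddChar a : ℂ)‖ < 2 := fun a ha =>
    norm_one_add_lt (norm_stdAddChar a) fun h =>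
      ha (injective_stdAddChar (h.trans (AddChar.map_zero_eq_one _).symm))
  -- The frequency `0`, where the norm equals 2, is neutralised by the dummy value 0.
  obtain ⟨b, hb⟩ := Finite.exists_max
    fun a : ZMod p => if a = 0 then (0 : ℝ) else ‖1 + (stdAddChar a : ℂ)‖ / 2
  refine ⟨if b = 0 then (0 : ℝ) else ‖1 + (stdAddChar b : ℂ)‖ / 2, ?_, ?_, fun a ha => ?_⟩
  · split_ifs <;> positivity
  · split_ifs with h
    · exact one_pos
    · linarith [hlt b h]
  · have := hb a
    rw [if_neg ha] at this
    linarith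

/-- The sum factors over coordinates, and each coordinate in the support of `φ` costs a factor `γ`.
-/
theorem norm_sum_stdAddChar_le {γ : ℝ}
    (hγ : ∀ a : ZMod p, a ≠ 0 → ‖1 + (stdAddChar a : ℂ)‖ ≤ 2 * γ) (φ : Fin n → ZMod p) :
    ‖∑ x : Cube n, (stdAddChar (φ ⬝ᵥ x.toZMod p) : ℂ)‖ ≤ γ ^ hammingNorm φ * 2 ^ n := by
  simp_rw [stdAddChar_dotProduct]
  rw [sum_cube_prod fun z b => if b then (stdAddChar (φ z) : ℂ) else 1, norm_prod]
  calc _ ≤ ∏ z, (if φ z ≠ 0 then γ else 1) * 2 := by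
        refine prod_le_prod (fun _ _ => norm_nonneg _) fun z _ => ?_
        by_cases h : φ z = 0
        · simp [h]
          norm_num
        · have := hγ (φ z) h
          simp only [if_true, Bool.false_eq_true, if_false, ne_eq, h, not_false_eq_true]
          rw [add_comm]
          linarith
    _ = _ := by
        rw [prod_mul_distrib, prod_ite]
        simp [hammingNorm]

/-- The Fourier coefficient of the uniform distribution on `A` at the form `φ` and the coordinate
set `T`. -/
noncomputable def coeff (A : Finset (Cube n)) (φ : Fin n → ZMod p) (T : Finset (Fin n)) : ℂ :=
  (∑ x ∈ A, (stdAddChar (φ ⬝ᵥ x.toZMod p) : ℂ) * walsh T x) / A.card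

/-- At distance `r` the correlations are at most `δ * η ^ 2 / 2`, half of the gain `η ^ 2 * δ` in
the almost orthogonality bound. -/
theorem card_separated_le {γ δ η : ℝ} (hγ0 : 0 ≤ γ) (hγ1 : γ ≤ 1)
    (hγ : ∀ a : ZMod p, a ≠ 0 → ‖1 + (stdAddChar a : ℂ)‖ ≤ 2 * γ) (hδ : 0 < δ) (hη : 0 < η)
    {r : ℕ} (hr : γ ^ r ≤ δ * η ^ 2 / 2) {A : Finset (Cube n)} (hA : A.Nonempty)
    (hAδ : δ ≤ density A) {ι : Type*} (K : Finset ι) (φ : ι → Fin n → ZMod p)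
    (hK : ∀ k ∈ K, η ≤ ‖coeff A (φ k) ∅‖)
    (hsep : ∀ k ∈ K, ∀ l ∈ K, k ≠ l → r ≤ hammingDist (φ k) (φ l)) :
    (K.card : ℝ) ≤ 2 / (δ * η ^ 2) := by
  have hApos : (0 : ℝ) < A.card := by exact_mod_cast card_pos.mpr hA
  have hcard : (Fintype.card (Cube n) : ℝ) = 2 ^ n := by simp
  have h := card_le_of_almost_orthogonal A K
    (fun k x => (stdAddChar (φ k ⬝ᵥ x.toZMod p) : ℂ)) (κ := δ * η ^ 2 / 2) hδ hη.le
    Fintype.card_pos ?_ ?_ ?_ (by positivity) ?_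
  · rw [le_div_iff₀ (by positivity)]
    linarith
  · rw [hcard]
    rwa [density, le_div_iff₀ (by positivity)] at hAδ
  · intro k _ x
    rw [norm_stdAddChar]
  · intro k hk
    have := hK k hk
    rw [coeff, norm_div, Complex.norm_natCast, le_div_iff₀ hApos] at this
    simpa [walsh] using this
  · intro k hk l hl hkl
    rw [hcard]
    have := norm_sum_stdAddChar_le hγ (φ k - φ l) (n := n)
    simp_rw [conj_stdAddChar, ← AddChar.map_add_eq_mul, ← sub_eq_add_neg, ← sub_dotProduct]
    refine this.trans ?_
    gcongr
    have hd : hammingNorm (φ k - φ l) = hammingDist (φ k) (φ l) := by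
      simp [hammingNorm, hammingDist, sub_ne_zero]
    rw [hd]
    exact (pow_le_pow_of_le_one hγ0 hγ1 (hsep k hk l hl hkl)).trans hr

/-- The common character cancels in every inner product, so the twisted Walsh functions are exactly
orthogonal. -/
theorem card_walsh_le {δ θ : ℝ} (hδ : 0 < δ) (hθ : 0 < θ) {A : Finset (Cube n)}
    (hA : A.Nonempty) (hAδ : δ ≤ density A) (φ : Fin n → ZMod p) (K : Finset (Finset (Fin n)))
    (hK : ∀ T ∈ K, θ ≤ ‖coeff A φ T‖) : (K.card : ℝ) ≤ 1 / (δ * θ ^ 2) := by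
  have hApos : (0 : ℝ) < A.card := by exact_mod_cast card_pos.mpr hA
  have hcard : (Fintype.card (Cube n) : ℝ) = 2 ^ n := by simp
  have h := card_le_of_almost_orthogonal A K
    (fun T x => (stdAddChar (φ ⬝ᵥ x.toZMod p) : ℂ) * walsh T x) (κ := 0) hδ hθ.le
    Fintype.card_pos ?_ ?_ ?_ le_rfl ?_
  · rw [le_div_iff₀ (by positivity)]
    linarith
  · rw [hcard]
    rwa [density, le_div_iff₀ (by positivity)] at hAδ
  · intro k _ x
    rw [norm_mul, norm_stdAddChar, norm_walsh, one_mul]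
  · intro k hk
    have := hK k hk
    rwa [coeff, norm_div, Complex.norm_natCast, le_div_iff₀ hApos] at this
  · intro T _ U _ hTU
    rw [zero_mul]
    refine le_of_eq (norm_eq_zero.mpr ?_)
    rw [← sum_walsh_mul_walsh hTU]
    refine sum_congr rfl fun x _ => ?_
    rw [map_mul, conj_stdAddChar, conj_walsh, AddChar.map_neg_eq_inv]
    have : (stdAddChar (φ ⬝ᵥ x.toZMod p) : ℂ) ≠ 0 := by
      rw [← norm_ne_zero_iff, norm_stdAddChar]
      exact one_ne_zero
    field_simp

/-- Small Fourier coefficients make functions of coordinates outside `S` behave as they do on the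
whole cube, even in the presence of the form `φ` and the coordinates in `S`. -/
theorem norm_sum_independent_le {θ : ℝ} {A : Finset (Cube n)} (φ : Fin n → ZMod p)
    {S S' : Finset (Fin n)} (hSS' : Disjoint S S') (hθ0 : 0 ≤ θ)
    (hθ : ∀ T ⊆ S ∪ S', ¬ T ⊆ S → ‖coeff A φ T‖ ≤ θ) {g h : Cube n → ℂ}
    (hgS : ∀ x y, (∀ z ∈ S, x z = y z) → g x = g y)
    (hhS : ∀ x y, (∀ z ∈ S', x z = y z) → h x = h y)
    (hg : ∀ x, ‖g x‖ ≤ 1) (hh : ∀ x, ‖h x‖ ≤ 1) :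
    ‖∑ x ∈ A, (stdAddChar (φ ⬝ᵥ x.toZMod p) : ℂ) * g x * (h x - cubeMean h)‖ ≤
      2 ^ (S.card + S'.card) * θ * A.card := by
  rcases A.eq_empty_or_nonempty with rfl | hA
  · simp
  have hApos : (0 : ℝ) < A.card := by exact_mod_cast card_pos.mpr hA
  -- Subtracting the mean removes the empty Walsh term. Every remaining `U` is non-empty and
  -- disjoint from `S`, so `T ∪ U` is never inside `S` and the bound `θ` applies.
  have hh' : ∀ x, h x - cubeMean h =
      ∑ U ∈ S'.powerset.erase ∅, cubeMean (fun y => h y * walsh U y) * walsh U x := by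
    intro x
    rw [sub_eq_iff_eq_add, sum_erase_eq_sub (empty_mem_powerset _), ← walsh_expansion S' h hhS x]
    simp [walsh]
  have hmean : ∀ f : Cube n → ℂ, (∀ x, ‖f x‖ ≤ 1) → ∀ T : Finset (Fin n),
      ‖cubeMean (fun y => f y * walsh T y)‖ ≤ 1 := fun f hf T =>
    norm_cubeMean_le fun x => by rw [norm_mul, norm_walsh, mul_one]; exact hf x
  have e : ∑ x ∈ A, (stdAddChar (φ ⬝ᵥ x.toZMod p) : ℂ) * g x * (h x - cubeMean h) =
      ∑ T ∈ S.powerset, ∑ U ∈ S'.powerset.erase ∅, cubeMean (fun y => g y * walsh T y) *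
        cubeMean (fun y => h y * walsh U y) * (coeff A φ (T ∪ U) * A.card) := by
    calc _ = ∑ x ∈ A, ∑ T ∈ S.powerset, ∑ U ∈ S'.powerset.erase ∅,
          cubeMean (fun y => g y * walsh T y) * cubeMean (fun y => h y * walsh U y) *
          ((stdAddChar (φ ⬝ᵥ x.toZMod p) : ℂ) * walsh (T ∪ U) x) := by
          refine sum_congr rfl fun x _ => ?_
          rw [hh' x, walsh_expansion S g hgS x, mul_assoc, sum_mul_sum, mul_sum]
          refine sum_congr rfl fun T hT => ?_
          rw [mul_sum]
          refine sum_congr rfl fun U hU => ?_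
          rw [walsh_union (hSS'.mono (mem_powerset.mp hT) (mem_powerset.mp (mem_of_mem_erase hU)))]
          ring
      _ = _ := by
          rw [sum_comm]
          refine sum_congr rfl fun T _ => ?_
          rw [sum_comm]
          refine sum_congr rfl fun U _ => ?_
          rw [← mul_sum, coeff, div_mul_cancel₀]
          exact_mod_cast hApos.ne'
  rw [e]
  calc _ ≤ ∑ T ∈ S.powerset, ∑ U ∈ S'.powerset.erase ∅, θ * A.card := by
        refine (norm_sum_le _ _).trans (sum_le_sum fun T hT => (norm_sum_le _ _).trans
          (sum_le_sum fun U hU => ?_))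
        rw [norm_mul, norm_mul, norm_mul, Complex.norm_natCast]
        refine (mul_le_of_le_one_left (by positivity)
          (mul_le_one₀ (hmean g hg T) (norm_nonneg _) (hmean h hh U))).trans ?_
        gcongr
        have hT' := mem_powerset.mp hT
        have hU' := mem_powerset.mp (mem_of_mem_erase hU)
        refine hθ _ (union_subset_union hT' hU') fun hsub => ne_of_mem_erase hU ?_
        have h1 : U ⊆ S := subset_union_right.trans hsub
        exact subset_empty.mp ((hSS' h1 hU').trans (by simp))
    _ ≤ ∑ T ∈ S.powerset, ∑ U ∈ S'.powerset, θ * A.card :=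
        sum_le_sum fun T _ => sum_le_sum_of_subset_of_nonneg (erase_subset _ _)
          fun _ _ _ => by positivity
    _ = _ := by
        simp only [sum_const, card_powerset, nsmul_eq_mul]
        push_cast
        ring

theorem indicator_eq_sum_stdAddChar (a b : ZMod p) : (if a = b then (1 : ℂ) else 0) =
    (∑ c : ZMod p, (stdAddChar (c * a) : ℂ) * stdAddChar (-(c * b))) / p := by
  have h := AddChar.sum_mulShift (a - b) (isPrimitive_stdAddChar p)
  simp_rw [← AddChar.map_add_eq_mul, ← sub_eq_add_neg, ← mul_sub]
  rw [h]
  simp only [sub_eq_zero]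
  have : (p : ℂ) ≠ 0 := by exact_mod_cast NeZero.ne p
  split_ifs <;> simp [ZMod.card, this]

end Fourier

/-! ### Structured forms and coordinates -/

section Structure

variable {p n : ℕ} [Fact p.Prime]

open ZMod

theorem hammingDist_smul_smul {a : ZMod p} (ha : a ≠ 0) (φ ψ : Fin n → ZMod p) :
    hammingDist (a • φ) (a • ψ) = hammingDist φ ψ :=
  hammingDist_smul fun _ => (IsUnit.mk0 a ha).isSMulRegular (ZMod p)

theorem hammingDist_smul_left {a : ZMod p} (ha : a ≠ 0) (φ ψ : Fin n → ZMod p) :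
    hammingDist (a • φ) ψ = hammingDist φ (a⁻¹ • ψ) := by
  rw [← hammingDist_smul_smul ha φ, smul_smul, mul_inv_cancel₀ ha, one_smul]

/-- Some non-zero multiple of `φ` has a large Fourier coefficient on `A`. -/
def IsStructured (A : Finset (Cube n)) (η : ℝ) (φ : Fin n → ZMod p) : Prop :=
  ∃ a : ZMod p, a ≠ 0 ∧ η ≤ ‖coeff A (a • φ) ∅‖

theorem IsStructured.smul {A : Finset (Cube n)} {η : ℝ} {φ : Fin n → ZMod p}
    (h : IsStructured A η φ) {a : ZMod p} (ha : a ≠ 0) : IsStructured A η (a • φ) := by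
  obtain ⟨b, hb, h⟩ := h
  refine ⟨b * a⁻¹, mul_ne_zero hb (inv_ne_zero ha), ?_⟩
  rwa [smul_smul, mul_assoc, inv_mul_cancel₀ ha, mul_one]

/-- Fourier inversion on `ZMod p`: the zero frequency gives `1 / p`, and the others average to at
most `η`. -/
theorem distr_ge_of_not_isStructured {A : Finset (Cube n)} (hA : A.Nonempty) {η : ℝ}
    {φ : Fin n → ZMod p} (h : ¬ IsStructured A η φ) (d : ZMod p) :
    1 / (p : ℝ) - η ≤ distr A (fun x => φ ⬝ᵥ x.toZMod p) d := by
  have hApos : (0 : ℝ) < A.card := by exact_mod_cast card_pos.mpr hA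
  have hA0 : (A.card : ℂ) ≠ 0 := by exact_mod_cast hApos.ne'
  have hp : (0 : ℝ) < p := by exact_mod_cast (Fact.out : p.Prime).pos
  have hp0 : (p : ℂ) ≠ 0 := by exact_mod_cast hp.ne'
  simp only [IsStructured, not_exists, not_and, not_le] at h
  have hη : 0 ≤ η := (norm_nonneg _).trans (h 1 one_ne_zero).le
  have e : ((distr A (fun x => φ ⬝ᵥ x.toZMod p) d : ℝ) : ℂ) - 1 / p =
      (∑ c ∈ univ.erase (0 : ZMod p), coeff A (c • φ) ∅ * stdAddChar (-(c * d))) / p := by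
    have h1 : ((distr A (fun x => φ ⬝ᵥ x.toZMod p) d : ℝ) : ℂ) =
        (∑ c : ZMod p, coeff A (c • φ) ∅ * stdAddChar (-(c * d))) / p := by
      rw [distr, card_filter]
      simp only [Complex.ofReal_div, Complex.ofReal_natCast, Complex.ofReal_sum, Nat.cast_sum,
        apply_ite Complex.ofReal, Complex.ofReal_one, Complex.ofReal_zero, Nat.cast_ite,
        Nat.cast_one, Nat.cast_zero]
      simp_rw [indicator_eq_sum_stdAddChar, coeff, smul_dotProduct, smul_eq_mul]
      rw [← sum_div, sum_comm, div_right_comm, sum_div]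
      congr 1
      refine sum_congr rfl fun c _ => ?_
      rw [← sum_mul, div_mul_eq_mul_div]
      simp [walsh]
    rw [h1, ← add_sum_erase univ _ (mem_univ (0 : ZMod p)), add_div]
    simp [coeff, walsh, hA0]
  have h2 : |distr A (fun x => φ ⬝ᵥ x.toZMod p) d - 1 / p| ≤ η := by
    calc _ = ‖((distr A (fun x => φ ⬝ᵥ x.toZMod p) d : ℝ) : ℂ) - 1 / p‖ := by
          rw [← Real.norm_eq_abs, ← Complex.norm_real]
          push_cast
          rfl
      _ ≤ (∑ _c : ZMod p, η) / p := by
          rw [e, norm_div, Complex.norm_natCast]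
          gcongr
          refine (norm_sum_le _ _).trans ((sum_le_sum fun c hc => ?_).trans
            (sum_le_sum_of_subset_of_nonneg (erase_subset (0 : ZMod p) univ) fun _ _ _ => hη))
          rw [norm_mul, norm_stdAddChar, mul_one]
          exact (h c (ne_of_mem_erase hc)).le
      _ = η := by
          rw [sum_const, card_univ, ZMod.card, nsmul_eq_mul]
          field_simp
  linarith [(abs_le.mp h2).1]

open Classical in
/-- The coordinates in a set of size at most `R` which has, together with a multiple of one of the
forms in `V`, a large Fourier coefficient on `A`. -/
noncomputable def structuredCoords (A : Finset (Cube n)) (θ : ℝ) (R : ℕ)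
    (V : Finset (Fin n → ZMod p)) : Finset (Fin n) :=
  univ.filter fun z => ∃ v ∈ V, ∃ a : ZMod p, ∃ T : Finset (Fin n),
    z ∈ T ∧ T.card ≤ R ∧ θ ≤ ‖coeff A (a • v) T‖

theorem mem_structuredCoords {A : Finset (Cube n)} {θ : ℝ} {R : ℕ}
    {V : Finset (Fin n → ZMod p)} {z : Fin n} : z ∈ structuredCoords A θ R V ↔
    ∃ v ∈ V, ∃ a : ZMod p, ∃ T : Finset (Fin n),
      z ∈ T ∧ T.card ≤ R ∧ θ ≤ ‖coeff A (a • v) T‖ := by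
  simp [structuredCoords]

theorem structuredCoords_mono (A : Finset (Cube n)) (θ : ℝ) (R : ℕ)
    {V V' : Finset (Fin n → ZMod p)} (h : V ⊆ V') :
    structuredCoords A θ R V ⊆ structuredCoords A θ R V' := by
  intro z hz
  rw [mem_structuredCoords] at hz ⊢
  obtain ⟨v, hv, h'⟩ := hz
  exact ⟨v, h hv, h'⟩

theorem card_structuredCoords_le {δ θ : ℝ} (hδ : 0 < δ) (hθ : 0 < θ) {A : Finset (Cube n)}
    (hA : A.Nonempty) (hAδ : δ ≤ density A) (R : ℕ) (V : Finset (Fin n → ZMod p)) :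
    (structuredCoords A θ R V).card ≤ V.card * (p * (⌊1 / (δ * θ ^ 2)⌋₊ * R)) := by
  classical
  have hsub : structuredCoords A θ R V ⊆ V.biUnion fun v => (univ : Finset (ZMod p)).biUnion
      fun a => (univ.filter fun T : Finset (Fin n) =>
        T.card ≤ R ∧ θ ≤ ‖coeff A (a • v) T‖).biUnion id := by
    intro z hz
    obtain ⟨v, hv, a, T, h1, h2, h3⟩ := mem_structuredCoords.mp hz
    simp only [mem_biUnion, mem_filter, mem_univ, true_and, id]
    exact ⟨v, hv, a, T, ⟨h2, h3⟩, h1⟩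
  refine (card_le_card hsub).trans (card_biUnion_le_card_mul _ _ _ fun v _ => ?_)
  refine (card_biUnion_le_card_mul _ _ (⌊1 / (δ * θ ^ 2)⌋₊ * R) fun a _ => ?_).trans
    (by rw [card_univ, ZMod.card])
  refine (card_biUnion_le_card_mul _ _ R fun T hT => (mem_filter.mp hT).2.1).trans ?_
  refine Nat.mul_le_mul_right _ (Nat.le_floor ?_)
  exact card_walsh_le hδ hθ hA hAδ (a • v) _ fun T hT => (mem_filter.mp hT).2.2

/-- A maximal separated family of forms with large coefficients is also a covering family. -/
theorem exists_centers {γ δ η : ℝ} (hγ0 : 0 ≤ γ) (hγ1 : γ ≤ 1)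
    (hγ : ∀ a : ZMod p, a ≠ 0 → ‖1 + (stdAddChar a : ℂ)‖ ≤ 2 * γ) (hδ : 0 < δ) (hη : 0 < η)
    {r : ℕ} (hr : γ ^ r ≤ δ * η ^ 2 / 2) {A : Finset (Cube n)} (hA : A.Nonempty)
    (hAδ : δ ≤ density A) :
    ∃ C : Finset (Fin n → ZMod p), C.card ≤ ⌊2 / (δ * η ^ 2)⌋₊ ∧
      ∀ φ, η ≤ ‖coeff A φ ∅‖ → ∃ ψ ∈ C, hammingDist φ ψ ≤ r := by
  classical
  set F : Finset (Finset (Fin n → ZMod p)) := univ.filter fun C =>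
    (∀ φ ∈ C, η ≤ ‖coeff A φ ∅‖) ∧ ∀ φ ∈ C, ∀ ψ ∈ C, φ ≠ ψ → r < hammingDist φ ψ with hF
  obtain ⟨C, hC, hmax⟩ := exists_max_image F card ⟨∅, by simp [hF]⟩
  simp only [hF, mem_filter, mem_univ, true_and] at hC hmax
  refine ⟨C, Nat.le_floor (card_separated_le hγ0 hγ1 hγ hδ hη hr hA hAδ C id hC.1
    fun k hk l hl hkl => (hC.2 k hk l hl hkl).le), fun φ hφ => ?_⟩
  by_contra! hcon
  have hφC : φ ∉ C := fun h => by simpa using hcon φ h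
  have := hmax (insert φ C) ⟨?_, ?_⟩
  · rw [card_insert_of_notMem hφC] at this
    omega
  · intro ψ hψ
    rcases mem_insert.mp hψ with rfl | hψ
    exacts [hφ, hC.1 ψ hψ]
  · intro ψ hψ₀ ψ' hψ'₀ hne
    rcases mem_insert.mp hψ₀ with rfl | hψ <;> rcases mem_insert.mp hψ'₀ with rfl | hψ'
    · exact absurd rfl hne
    · exact hcon ψ' hψ'
    · rw [hammingDist_comm]
      exact hcon ψ hψ
    · exact hC.2 ψ hψ ψ' hψ' hne

/-- The pair `(V, Z)` of a set of forms and a set of coordinates is a skeleton of `A` if the forms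
in `V` are far apart up to scaling, each close to a structured form of `A`, and all the coordinates
in `Z` are structured relative to `V`. -/
def IsSkeleton (η θ : ℝ) (r : ℕ) (st : Finset (Fin n → ZMod p) × Finset (Fin n))
    (A : Finset (Cube n)) : Prop :=
  (∀ v ∈ st.1, ∀ v' ∈ st.1, v ≠ v' → ∀ a : ZMod p, a ≠ 0 → 3 * r < hammingDist v (a • v')) ∧
  (∀ v ∈ st.1, ∃ φ, hammingDist φ v ≤ r ∧ IsStructured A η φ) ∧
  st.2 ⊆ structuredCoords A θ (4 * r) st.1

/-- `A` and `A'` share some structure not captured by `(V, Z)`. -/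
def IsLinked (η θ : ℝ) (r : ℕ) (st : Finset (Fin n → ZMod p) × Finset (Fin n))
    (A A' : Finset (Cube n)) : Prop :=
  (∃ φ, IsStructured A η φ ∧ IsStructured A' η φ ∧
    ∀ v ∈ st.1, ∀ a : ZMod p, a ≠ 0 → 4 * r < hammingDist φ (a • v)) ∨
  ∃ z, z ∉ st.2 ∧ z ∈ structuredCoords A θ (4 * r) st.1 ∧ z ∈ structuredCoords A' θ (4 * r) st.1

/-- Replacing each form of `V` by a suitable multiple of a structured form within `r` lowers the
separation from `3 * r` to no less than `r`, so `card_separated_le` applies. -/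
theorem IsSkeleton.card_fst_le {γ δ η θ : ℝ} (hγ0 : 0 ≤ γ) (hγ1 : γ ≤ 1)
    (hγ : ∀ a : ZMod p, a ≠ 0 → ‖1 + (stdAddChar a : ℂ)‖ ≤ 2 * γ) (hδ : 0 < δ) (hη : 0 < η)
    {r : ℕ} (hr : γ ^ r ≤ δ * η ^ 2 / 2) {A : Finset (Cube n)} (hA : A.Nonempty)
    (hAδ : δ ≤ density A) {st : Finset (Fin n → ZMod p) × Finset (Fin n)}
    (h : IsSkeleton η θ r st A) : st.1.card ≤ ⌊2 / (δ * η ^ 2)⌋₊ := by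
  have h2 : ∀ v : Fin n → ZMod p, ∃ a : ZMod p, ∃ φ, v ∈ st.1 →
      hammingDist φ v ≤ r ∧ a ≠ 0 ∧ η ≤ ‖coeff A (a • φ) ∅‖ := by
    intro v
    by_cases hv : v ∈ st.1
    · obtain ⟨φ, h1, a, h2, h3⟩ := h.2.1 v hv
      exact ⟨a, φ, fun _ => ⟨h1, h2, h3⟩⟩
    · exact ⟨0, 0, fun h => absurd h hv⟩
  choose a φ hφ using h2
  refine Nat.le_floor (card_separated_le hγ0 hγ1 hγ hδ hη hr hA hAδ st.1 (fun v => a v • φ v)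
    (fun v hv => (hφ v hv).2.2) fun v hv w hw hvw => ?_)
  have h1 := h.1 v hv w hw hvw ((a v)⁻¹ * a w)
    (mul_ne_zero (inv_ne_zero (hφ v hv).2.1) (hφ w hw).2.1)
  rw [← smul_smul, ← hammingDist_smul_left (hφ v hv).2.1] at h1
  have t1 := hammingDist_triangle (a v • v) (a v • φ v) (a w • w)
  have t2 := hammingDist_triangle (a v • φ v) (a w • φ w) (a w • w)
  rw [hammingDist_smul_smul (hφ v hv).2.1, hammingDist_comm v] at t1
  rw [hammingDist_smul_smul (hφ w hw).2.1] at t2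
  have := (hφ v hv).1
  have := (hφ w hw).1
  omega

/-- The candidates depend on `A` alone, which makes pigeonholing over `A'` possible. A shared form
more than `4 * r` from the multiples of `V` is, after scaling, within `r` of a centre, and that
centre keeps distance more than `3 * r`. -/
theorem IsSkeleton.exists_extensions {γ δ η θ : ℝ} (hγ0 : 0 ≤ γ) (hγ1 : γ ≤ 1)
    (hγ : ∀ a : ZMod p, a ≠ 0 → ‖1 + (stdAddChar a : ℂ)‖ ≤ 2 * γ) (hδ : 0 < δ) (hη : 0 < η)
    {r : ℕ} (hr : γ ^ r ≤ δ * η ^ 2 / 2) {A : Finset (Cube n)} (hA : A.Nonempty)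
    (hAδ : δ ≤ density A) (st : Finset (Fin n → ZMod p) × Finset (Fin n)) :
    ∃ O : Finset (Finset (Fin n → ZMod p) × Finset (Fin n)),
      O.card ≤ ⌊2 / (δ * η ^ 2)⌋₊ + (structuredCoords A θ (4 * r) st.1).card ∧
      (∀ st' ∈ O, st'.1.card + st'.2.card = st.1.card + st.2.card + 1) ∧
      ∀ A', IsSkeleton η θ r st A' → IsLinked η θ r st A A' → ∃ st' ∈ O, IsSkeleton η θ r st' A' := by
  classical
  obtain ⟨C, hC, hC'⟩ := exists_centers hγ0 hγ1 hγ hδ hη hr hA hAδ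
  refine ⟨((C.filter (· ∉ st.1)).image fun ψ => (insert ψ st.1, st.2)) ∪
    (((structuredCoords A θ (4 * r) st.1).filter (· ∉ st.2)).image
      fun z => (st.1, insert z st.2)), ?_, ?_, ?_⟩
  · exact (card_union_le _ _).trans (Nat.add_le_add
      (card_image_le.trans ((card_filter_le _ _).trans hC))
      (card_image_le.trans (card_filter_le _ _)))
  · intro st' h
    rcases mem_union.mp h with h | h <;> obtain ⟨w, hw, rfl⟩ := mem_image.mp h <;>
      simp only [card_insert_of_notMem (mem_filter.mp hw).2] <;> omega
  · rintro A' hA' (⟨φ, ⟨a, ha, hφ⟩, hφ', hfar⟩ | ⟨z, hz, hzA, hzA'⟩)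
    · obtain ⟨ψ, hψ, hd⟩ := hC' _ hφ
      have hfar' : ∀ v ∈ st.1, ∀ b : ZMod p, b ≠ 0 → 4 * r < hammingDist (a • φ) (b • v) := by
        intro v hv b hb
        rw [hammingDist_smul_left ha, smul_smul]
        exact hfar v hv _ (mul_ne_zero (inv_ne_zero ha) hb)
      have hsep : ∀ v ∈ st.1, ∀ b : ZMod p, b ≠ 0 → 3 * r < hammingDist ψ (b • v) := by
        intro v hv b hb
        have h1 := hfar' v hv b hb
        have h2 := hammingDist_triangle (a • φ) ψ (b • v)
        omega
      have hψV : ψ ∉ st.1 := by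
        intro h
        have := hsep ψ h 1 one_ne_zero
        simp at this
      refine ⟨_, mem_union_left _ (mem_image_of_mem _ (mem_filter.mpr ⟨hψ, hψV⟩)), ?_, ?_, ?_⟩
      · intro v hv₀ v' hv'₀ hne b hb
        rcases mem_insert.mp hv₀ with rfl | hv <;> rcases mem_insert.mp hv'₀ with rfl | hv'
        · exact absurd rfl hne
        · exact hsep v' hv' b hb
        · have := hsep v hv b⁻¹ (inv_ne_zero hb)
          rwa [← hammingDist_smul_left hb, hammingDist_comm] at this
        · exact hA'.1 v hv v' hv' hne b hb
      · intro v hv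
        rcases mem_insert.mp hv with rfl | hv
        · exact ⟨a • φ, hd, hφ'.smul ha⟩
        · exact hA'.2.1 v hv
      · exact hA'.2.2.trans (structuredCoords_mono _ _ _ (subset_insert _ _))
    · refine ⟨_, mem_union_right _ (mem_image_of_mem _ (mem_filter.mpr ⟨hzA, hz⟩)),
        hA'.1, hA'.2.1, ?_⟩
      exact insert_subset hzA' hA'.2.2

end Structure

/-! ### Overlaps of tuples without links -/

section Overlap

variable {p n : ℕ} [Fact p.Prime]

open ZMod

theorem exists_popular_value (B : Finset (Cube n)) (φ : Fin n → ZMod p) :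
    ∃ d, B.card ≤ p * (B.filter fun x => φ ⬝ᵥ x.toZMod p = d).card := by
  by_contra! h
  have h1 := card_eq_sum_card_fiberwise (s := B) (t := univ)
    (f := fun x : Cube n => φ ⬝ᵥ x.toZMod p) (fun _ _ => by simp)
  have h2 : p * B.card < p * B.card := by
    calc p * B.card = ∑ d : ZMod p, p * (B.filter fun x => φ ⬝ᵥ x.toZMod p = d).card := by
          rw [← mul_sum, ← h1]
      _ < ∑ _d : ZMod p, B.card := sum_lt_sum_of_nonempty univ_nonempty fun d _ => h d
      _ = p * B.card := by simp [ZMod.card]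
  exact lt_irrefl _ h2

/-- A value that `φ` takes most often on `B`. -/
noncomputable def popularValue (B : Finset (Cube n)) (φ : Fin n → ZMod p) : ZMod p :=
  (exists_popular_value B φ).choose

theorem card_le_mul_popularValue (B : Finset (Cube n)) (φ : Fin n → ZMod p) :
    B.card ≤ p * (B.filter fun x => φ ⬝ᵥ x.toZMod p = popularValue B φ).card :=
  (exists_popular_value B φ).choose_spec

theorem dotProduct_congr_of_support {S : Finset (Fin n)} {φ : Fin n → ZMod p}
    (hφ : ∀ z ∉ S, φ z = 0) {x y : Cube n} (h : ∀ z ∈ S, x z = y z) :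
    φ ⬝ᵥ x.toZMod p = φ ⬝ᵥ y.toZMod p := by
  rw [dotProduct_toZMod, dotProduct_toZMod]
  refine sum_congr rfl fun z _ => ?_
  by_cases hz : z ∈ S
  · rw [h z hz]
  · simp [hφ z hz]

/-- The form `σ`, whose support avoids the structured coordinates, is nearly independent on `A` of
forms supported on `S` up to `ω`. -/
theorem card_filter_independent {θ : ℝ} (hθ0 : 0 ≤ θ) {A : Finset (Cube n)}
    {S S' : Finset (Fin n)} (hSS' : Disjoint S S') (ω ξ β σ : Fin n → ZMod p)
    (hθ : ∀ b : ZMod p, ∀ T ⊆ S ∪ S', ¬ T ⊆ S → ‖coeff A (b • ω) T‖ ≤ θ)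
    (hξ : ∀ z ∉ S, ξ z = 0) (hβ : ∀ z ∉ S, β z = 0) (hσ : ∀ z ∉ S', σ z = 0) (d c e : ZMod p)
    (y : Cube n) (hy : σ ⬝ᵥ y.toZMod p = e) :
    ((A.filter fun x => (ω + ξ) ⬝ᵥ x.toZMod p = d ∧ β ⬝ᵥ x.toZMod p = c).card : ℝ) /
        2 ^ (p - 1) - 2 ^ (S.card + S'.card) * θ * A.card ≤
      (A.filter fun x => ((ω + ξ) ⬝ᵥ x.toZMod p = d ∧ β ⬝ᵥ x.toZMod p = c) ∧
        σ ⬝ᵥ x.toZMod p = e).card := by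
  have hp : (0 : ℝ) < p := by exact_mod_cast (Fact.out : p.Prime).pos
  set h : Cube n → ℂ := fun x => if σ ⬝ᵥ x.toZMod p = e then 1 else 0 with hh
  set u : ℝ := ((univ.filter fun x : Cube n => σ ⬝ᵥ x.toZMod p = e).card : ℝ) / 2 ^ n with hu
  have hmean : cubeMean h = u := by
    simp [cubeMean, hh, hu]
  have hu' : 1 / 2 ^ (p - 1) ≤ u := by
    rw [hu, div_le_div_iff₀ (by positivity) (by positivity), one_mul]
    exact_mod_cast two_pow_le_card_fiber n σ e y hy
  set N₁ := (A.filter fun x => ((ω + ξ) ⬝ᵥ x.toZMod p = d ∧ β ⬝ᵥ x.toZMod p = c) ∧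
        σ ⬝ᵥ x.toZMod p = e).card with hN₁
  set N₂ := (A.filter fun x => (ω + ξ) ⬝ᵥ x.toZMod p = d ∧ β ⬝ᵥ x.toZMod p = c).card with hN₂
  -- Expanding the event `(ω + ξ) ⬝ᵥ x = d` in characters, frequency `b` contributes the character
  -- of `b • ω` times `g b`, which depends only on coordinates in `S`.
  let g : ZMod p → Cube n → ℂ := fun b x =>
    (stdAddChar (b * (ξ ⬝ᵥ x.toZMod p)) : ℂ) * stdAddChar (-(b * d)) *
      if β ⬝ᵥ x.toZMod p = c then 1 else 0
  have hg : ∀ b x, ‖g b x‖ ≤ 1 := by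
    intro b x
    simp only [g]
    rw [norm_mul, norm_mul, norm_stdAddChar, norm_stdAddChar]
    split_ifs <;> simp
  have hgS : ∀ b x y, (∀ z ∈ S, x z = y z) → g b x = g b y := by
    intro b x y hxy
    simp only [g]
    rw [dotProduct_congr_of_support hξ hxy, dotProduct_congr_of_support hβ hxy]
  have key := fun b => norm_sum_independent_le (b • ω) hSS' hθ0 (hθ b) (hgS b)
    (h := h) (fun x y hxy => by simp only [hh]; rw [dotProduct_congr_of_support hσ hxy])
    (hg b) (fun x => by simp only [hh]; split_ifs <;> simp)
  have e1 : (((N₁ : ℝ) - N₂ * u : ℝ) : ℂ) = (∑ b : ZMod p, ∑ x ∈ A,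
      (stdAddChar ((b • ω) ⬝ᵥ x.toZMod p) : ℂ) * g b x * (h x - cubeMean h)) / p := by
    have e2 : ∀ x : Cube n, (∑ b : ZMod p,
        (stdAddChar ((b • ω) ⬝ᵥ x.toZMod p) : ℂ) * g b x * (h x - cubeMean h)) / p =
        (if (ω + ξ) ⬝ᵥ x.toZMod p = d ∧ β ⬝ᵥ x.toZMod p = c then 1 else 0) *
          (h x - cubeMean h) := by
      intro x
      have e3 := indicator_eq_sum_stdAddChar ((ω + ξ) ⬝ᵥ x.toZMod p) d
      have e4 : (if (ω + ξ) ⬝ᵥ x.toZMod p = d ∧ β ⬝ᵥ x.toZMod p = c then (1 : ℂ) else 0) =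
          (if (ω + ξ) ⬝ᵥ x.toZMod p = d then 1 else 0) *
            (if β ⬝ᵥ x.toZMod p = c then 1 else 0) := by
        rw [ite_and, ite_zero_mul, one_mul]
      rw [e4, e3, div_mul_eq_mul_div, div_mul_eq_mul_div, sum_mul, sum_mul]
      congr 1
      refine sum_congr rfl fun b _ => ?_
      simp only [g]
      rw [add_dotProduct, smul_dotProduct, smul_eq_mul, mul_add, AddChar.map_add_eq_mul]
      ring
    have e5 : (N₁ : ℂ) = ∑ x ∈ A,
        (if (ω + ξ) ⬝ᵥ x.toZMod p = d ∧ β ⬝ᵥ x.toZMod p = c then 1 else 0) * h x := by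
      rw [hN₁, card_filter, Nat.cast_sum]
      refine sum_congr rfl fun x _ => ?_
      rw [ite_and, ite_zero_mul, one_mul]
      simp only [hh, Nat.cast_ite, Nat.cast_one, Nat.cast_zero]
    have e6 : (N₂ : ℂ) = ∑ x ∈ A,
        (if (ω + ξ) ⬝ᵥ x.toZMod p = d ∧ β ⬝ᵥ x.toZMod p = c then 1 else 0) := by
      rw [hN₂, card_filter, Nat.cast_sum]
      simp only [Nat.cast_ite, Nat.cast_one, Nat.cast_zero]
    rw [sum_comm, sum_div]
    simp_rw [e2, mul_sub, sum_sub_distrib, ← sum_mul, hmean]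
    push_cast
    rw [e5, e6]
  have h2 : |(N₁ : ℝ) - N₂ * u| ≤ 2 ^ (S.card + S'.card) * θ * A.card := by
    rw [← Real.norm_eq_abs, ← Complex.norm_real, e1, norm_div, Complex.norm_natCast,
      div_le_iff₀ hp]
    refine (norm_sum_le _ _).trans ((sum_le_sum fun b _ => key b).trans (le_of_eq ?_))
    rw [sum_const, card_univ, ZMod.card, nsmul_eq_mul]
    ring
  have h3 : (N₂ : ℝ) / 2 ^ (p - 1) ≤ N₂ * u := by
    rw [div_eq_mul_one_div]
    gcongr
  linarith [(abs_le.mp h2).1]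

/-- The restriction of a form to a set of coordinates. -/
def restrictForm (Z : Finset (Fin n)) (φ : Fin n → ZMod p) : Fin n → ZMod p :=
  fun z => if z ∈ Z then φ z else 0

/-- Values attained by a form on each of several disjoint blocks of coordinates can be attained
simultaneously. -/
theorem exists_sum_blocks {ι : Type*} (I : Finset ι) (W : ι → Finset (Fin n))
    (hW : ∀ s ∈ I, ∀ s' ∈ I, s ≠ s' → Disjoint (W s) (W s')) (φ : Fin n → ZMod p)
    (x : ι → Cube n) (Y : Finset (Fin n)) (hY : ∀ s ∈ I, W s ⊆ Y) :
    ∃ y : Cube n, restrictForm Y φ ⬝ᵥ y.toZMod p =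
      ∑ s ∈ I, restrictForm (W s) φ ⬝ᵥ (x s).toZMod p := by
  classical
  refine ⟨fun z => decide (∃ s ∈ I, z ∈ W s ∧ x s z), ?_⟩
  simp_rw [dotProduct_toZMod]
  rw [sum_comm]
  refine sum_congr rfl fun z _ => ?_
  by_cases hz : ∃ s ∈ I, z ∈ W s
  · obtain ⟨s, hs, hzs⟩ := hz
    have huniq : ∀ s' ∈ I, z ∈ W s' → s' = s := fun s' hs' hz' => by
      by_contra hne
      exact disjoint_left.mp (hW s' hs' s hs hne) hz' hzs
    rw [sum_eq_single_of_mem s hs]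
    · have h1 : (∃ s ∈ I, z ∈ W s ∧ x s z = true) ↔ x s z = true := by
        constructor
        · rintro ⟨s', hs', hz', hx⟩
          rwa [huniq s' hs' hz'] at hx
        · exact fun hx => ⟨s, hs, hzs, hx⟩
      simp [h1, restrictForm, hzs, hY s hs hzs]
    · intro s' hs' hne
      have : z ∉ W s' := fun h => hne (huniq s' hs' h)
      simp [restrictForm, this]
  · push Not at hz
    have h1 : ¬ ∃ s ∈ I, z ∈ W s ∧ x s z = true := fun ⟨s, hs, h, _⟩ => hz s hs h
    rw [sum_eq_zero fun s hs => by simp [restrictForm, hz s hs]]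
    simp [h1]

theorem prime_le_two_pow (p : ℕ) (hp : 1 ≤ p) : (p : ℝ) ≤ 2 ^ (p - 1) := by
  have : p - 1 < 2 ^ (p - 1) := Nat.lt_two_pow_self
  exact_mod_cast (by omega : p ≤ 2 ^ (p - 1))

theorem le_overlap {m : ℕ} [NeZero m] {A : Fin m → Finset (Cube n)} (φ : Fin n → ZMod p)
    {b : ℝ} (d : ZMod p) (h : ∀ t, b ≤ distr (A t) (fun x => φ ⬝ᵥ x.toZMod p) d) :
    b ≤ overlap fun t => distr (A t) fun x => φ ⬝ᵥ x.toZMod p := by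
  have hnn : ∀ d, 0 ≤ ⨅ t, distr (A t) (fun x => φ ⬝ᵥ x.toZMod p) d := fun d =>
    Real.iInf_nonneg fun t => by unfold distr; positivity
  exact (le_ciInf h).trans (single_le_sum (f := fun d => ⨅ t, distr (A t)
    (fun x => φ ⬝ᵥ x.toZMod p) d) (fun d _ => hnn d) (mem_univ d))

theorem inv_mul_le_div_of_le {a b P M : ℝ} (hP : 0 < P) (hM : P ^ 3 ≤ M) (hb : 0 ≤ b)
    (h : a ≤ P * (P * b)) : M⁻¹ * a ≤ b / P := by
  have hM0 : 0 < M := lt_of_lt_of_le (by positivity) hM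
  calc M⁻¹ * a ≤ (P ^ 3)⁻¹ * (P * (P * b)) :=
        (mul_le_mul_of_nonneg_left h (by positivity)).trans
          (mul_le_mul_of_nonneg_right (inv_anti₀ (by positivity) hM) (by positivity))
    _ = b / P := by field_simp

theorem overlap_ge_of_forall_not_isLinked {m : ℕ} (hm : 2 ≤ m) {A : Fin m → Finset (Cube n)}
    (hA : ∀ t, (A t).Nonempty) {η θ ν : ℝ} {r : ℕ} (hθ : 0 ≤ θ) (hν : 0 ≤ ν) (hην : η ≤ ν)
    (hθν : 2 ^ (4 * r) * θ ≤ ν) {V : Finset (Fin n → ZMod p)} {Z : Finset (Fin n)}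
    (hskel : ∀ t, Z ⊆ structuredCoords (A t) θ (4 * r) V)
    (hpop : ∀ v ∈ V, ∀ a : ZMod p, ∀ ξ : Fin n → ZMod p, (∀ z ∉ Z, ξ z = 0) → ∀ t t',
      popularValue (A t) (a • v + ξ) = popularValue (A t') (a • v + ξ))
    (hlink : ∀ t t', t ≠ t' → ¬ IsLinked η θ r (V, Z) (A t) (A t')) (φ : Fin n → ZMod p) :
    ((2 : ℝ) ^ ((m + 1) * (p - 1)))⁻¹ - ν ≤
      overlap fun t => distr (A t) fun x => φ ⬝ᵥ x.toZMod p := by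
  classical
  have : NeZero m := ⟨by omega⟩
  have hp1 : 1 ≤ p := (Fact.out : p.Prime).one_lt.le
  have hp : (0 : ℝ) < p := by exact_mod_cast hp1
  have hp2 := prime_le_two_pow p hp1
  have hpow0 : (0 : ℝ) < 2 ^ (p - 1) := by positivity
  have hpow : ((2 : ℝ) ^ (p - 1)) ^ 3 ≤ 2 ^ ((m + 1) * (p - 1)) := by
    rw [← pow_mul, mul_comm (p - 1)]
    exact pow_le_pow_right₀ (by norm_num) (Nat.mul_le_mul_right _ (by omega))
  have hApos : ∀ t, (0 : ℝ) < (A t).card := fun t => by exact_mod_cast card_pos.mpr (hA t)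
  by_cases hstr : ∃ t t', t ≠ t' ∧ IsStructured (A t) η φ ∧ IsStructured (A t') η φ
  · obtain ⟨t₁, t₂, hne, hs₁, hs₂⟩ := hstr
    have hnear : ∃ v ∈ V, ∃ a : ZMod p, a ≠ 0 ∧ hammingDist φ (a • v) ≤ 4 * r := by
      by_contra! hcon
      exact hlink t₁ t₂ hne (Or.inl ⟨φ, hs₁, hs₂, hcon⟩)
    obtain ⟨v, hv, a, -, hd⟩ := hnear
    set χ := φ - a • v with hχ
    set S := univ.filter fun z => χ z ≠ 0 with hS
    have hScard : S.card ≤ 4 * r := by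
      refine le_trans (le_of_eq ?_) hd
      simp [hS, hχ, hammingDist, sub_ne_zero]
    set W := fun t => structuredCoords (A t) θ (4 * r) V with hW
    -- A structured coordinate shared by two sets outside `Z` would link them.
    have hdisj : ∀ t t', t ≠ t' → Disjoint (W t \ Z) (W t' \ Z) := by
      intro t t' hne
      rw [disjoint_left]
      intro z hz hz'
      exact hlink t t' hne (Or.inr ⟨z, (mem_sdiff.mp hz).2, (mem_sdiff.mp hz).1,
        (mem_sdiff.mp hz').1⟩)
    set α := a • v + restrictForm Z χ with hα
    set d₀ := popularValue (A t₁) α with hd₀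
    have hd₀' : ∀ t, popularValue (A t) α = d₀ := fun t =>
      hpop v hv a _ (fun z hz => by simp [restrictForm, hz]) t t₁
    set B := fun t => (A t).filter fun x => α ⬝ᵥ x.toZMod p = d₀ with hB
    set c := fun t => popularValue (B t) (restrictForm (W t \ Z) χ) with hc
    set D := fun t => (A t).filter fun x => α ⬝ᵥ x.toZMod p = d₀ ∧
      restrictForm (W t \ Z) χ ⬝ᵥ x.toZMod p = c t with hD
    have hDcard : ∀ t, (A t).card ≤ p * (p * (D t).card) := by
      intro t
      have h1 := card_le_mul_popularValue (A t) α
      rw [hd₀'] at h1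
      have h2 := card_le_mul_popularValue (B t) (restrictForm (W t \ Z) χ)
      rw [hB, filter_filter] at h2
      exact h1.trans (Nat.mul_le_mul_left _ h2)
    have hDne : ∀ t, ∃ x, x ∈ D t := fun t => by
      by_contra! h
      have h1 := hDcard t
      rw [eq_empty_of_forall_notMem h] at h1
      have := card_pos.mpr (hA t)
      rw [card_empty, mul_zero, mul_zero] at h1
      omega
    choose x hx using hDne
    -- The target is the same for all `t`. On `A t`, the coordinates outside `W t` must supply the
    -- `c s` with `s ≠ t`; gluing the witnesses `x s` on their private blocks shows that this is
    -- possible.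
    refine le_overlap φ (d₀ + ∑ s, c s) fun t => ?_
    obtain ⟨y, hy⟩ := exists_sum_blocks (univ.erase t) (fun s => W s \ Z)
      (fun s _ s' _ hne => hdisj s s' hne) χ x (W t)ᶜ (fun s hs z hz => by
        rw [mem_compl]
        intro hzt
        exact disjoint_left.mp (hdisj s t (ne_of_mem_erase hs)) hz
          (mem_sdiff.mpr ⟨hzt, (mem_sdiff.mp hz).2⟩))
    rw [sum_congr rfl fun s _ => (mem_filter.mp (hx s)).2.2] at hy
    have hφ : φ = α + restrictForm (W t \ Z) χ + restrictForm (W t)ᶜ χ := by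
      have h1 : φ = a • v + χ := by rw [hχ]; abel
      rw [hα, add_assoc, add_assoc]
      conv_lhs => rw [h1]
      congr 1
      funext z
      have h2 : z ∈ Z → z ∈ W t := fun h => hskel t h
      by_cases hzZ : z ∈ Z
      · simp [restrictForm, hzZ, h2 hzZ]
      · by_cases hzW : z ∈ W t <;> simp [restrictForm, hzZ, hzW]
    have hsupp : ∀ z, z ∉ S → χ z = 0 := fun z hz => by simpa [hS] using hz
    have hSS : S ∩ W t ∪ S \ W t = S := sup_inf_sdiff S (W t)
    have hSc : (S ∩ W t).card + (S \ W t).card = S.card := card_inter_add_card_sdiff S (W t)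
    have key := card_filter_independent hθ (A := A t) (S := S ∩ W t) (S' := S \ W t)
      (disjoint_left.mpr fun z h1 h2 => (mem_sdiff.mp h2).2 (mem_inter.mp h1).2)
      (a • v) (restrictForm Z χ) (restrictForm (W t \ Z) χ) (restrictForm (W t)ᶜ χ)
      -- A large coefficient at `T ⊆ S` would make all coordinates of `T` structured, since `T` has
      -- at most `4 * r` elements.
      (fun b T hT hT' => by
        rw [hSS] at hT
        by_contra! hcon
        refine hT' fun z hz => mem_inter.mpr ⟨hT hz, ?_⟩
        refine mem_structuredCoords.mpr ⟨v, hv, b * a, T, hz, (card_le_card hT).trans hScard, ?_⟩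
        rw [← smul_smul]
        exact hcon.le)
      (fun z hz => by
        by_cases hzZ : z ∈ Z
        · have : z ∉ S := fun h => hz (mem_inter.mpr ⟨h, hskel t hzZ⟩)
          simp [restrictForm, hsupp z this]
        · simp [restrictForm, hzZ])
      (fun z hz => by
        by_cases hzW : z ∈ W t
        · have : z ∉ S := fun h => hz (mem_inter.mpr ⟨h, hzW⟩)
          simp [restrictForm, hsupp z this]
        · simp [restrictForm, hzW])
      (fun z hz => by
        by_cases hzW : z ∈ W t
        · simp [restrictForm, hzW]
        · have : z ∉ S := fun h => hz (mem_sdiff.mpr ⟨h, hzW⟩)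
          simp [restrictForm, hsupp z this])
      d₀ (c t) (∑ s ∈ univ.erase t, c s) y hy
    rw [hSc] at key
    have hsub : ((A t).filter fun x => (α ⬝ᵥ x.toZMod p = d₀ ∧
        restrictForm (W t \ Z) χ ⬝ᵥ x.toZMod p = c t) ∧
        restrictForm (W t)ᶜ χ ⬝ᵥ x.toZMod p = ∑ s ∈ univ.erase t, c s) ⊆
        (A t).filter fun x => φ ⬝ᵥ x.toZMod p = d₀ + ∑ s, c s := by
      intro x hx
      obtain ⟨h1, ⟨h2, h3⟩, h4⟩ := mem_filter.mp hx
      refine mem_filter.mpr ⟨h1, ?_⟩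
      rw [hφ, add_dotProduct, add_dotProduct, h2, h3, h4, add_assoc, add_sum_erase _ _ (mem_univ t)]
    have hsub' := (Nat.cast_le (α := ℝ)).mpr (card_le_card hsub)
    have hDreal : ((A t).card : ℝ) ≤ p * (p * (D t).card) := by exact_mod_cast hDcard t
    have herr : 2 ^ S.card * θ ≤ ν := by
      refine le_trans ?_ hθν
      gcongr
      norm_num
    rw [distr, le_div_iff₀ (hApos t), sub_mul]
    have hmain : ((2 : ℝ) ^ ((m + 1) * (p - 1)))⁻¹ * (A t).card ≤ (D t).card / 2 ^ (p - 1) := by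
      exact inv_mul_le_div_of_le hpow0 hpow (Nat.cast_nonneg _) (hDreal.trans
        (mul_le_mul hp2 (mul_le_mul_of_nonneg_right hp2 (Nat.cast_nonneg _))
          (mul_nonneg hp.le (Nat.cast_nonneg _)) hpow0.le))
    have herr' : 2 ^ S.card * θ * (A t).card ≤ ν * (A t).card :=
      mul_le_mul_of_nonneg_right herr (Nat.cast_nonneg _)
    have key' := key.trans hsub'
    linarith
  · push Not at hstr
    have hbound : ((2 : ℝ) ^ ((m + 1) * (p - 1)))⁻¹ ≤ 1 / p := by
      rw [one_div]
      gcongr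
      exact hp2.trans (pow_le_pow_right₀ (by norm_num) (Nat.le_mul_of_pos_left _ (by omega)))
    have hunif : ∀ t, ¬ IsStructured (A t) η φ → ∀ d, ((2 : ℝ) ^ ((m + 1) * (p - 1)))⁻¹ - ν ≤
        distr (A t) (fun x => φ ⬝ᵥ x.toZMod p) d := fun t ht d => by
      have := distr_ge_of_not_isStructured (hA t) ht d
      linarith
    by_cases h1 : ∃ t, IsStructured (A t) η φ
    · obtain ⟨t₁, ht₁⟩ := h1
      refine le_overlap φ (popularValue (A t₁) φ) fun t => ?_
      by_cases ht : t = t₁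
      · subst ht
        have h2 := (Nat.cast_le (α := ℝ)).mpr (card_le_mul_popularValue (A t) φ)
        rw [Nat.cast_mul] at h2
        have h3 : 1 / (p : ℝ) ≤ distr (A t) (fun x => φ ⬝ᵥ x.toZMod p) (popularValue (A t) φ) := by
          rw [distr, div_le_div_iff₀ hp (hApos t)]
          linarith
        linarith
      · exact hunif t (hstr t₁ t (Ne.symm ht) ht₁) _
    · push Not at h1
      exact le_overlap φ 0 fun t => hunif t (h1 t) 0

end Overlap

/-! ### Linear-sized families -/

/-- The colour records all the relevant popular values; there are finitely many because `ξ` is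
determined by its restriction to `Z`. -/
theorem exists_color (p n N : ℕ) [Fact p.Prime] {ι : Type}
    (A : ι → Finset (Cube n)) (V : Finset (Fin n → ZMod p)) (Z : Finset (Fin n))
    (hV : V.card ≤ N) (hZ : Z.card ≤ N) :
    ∃ κ : ι → ℕ, (∀ i, κ i < p ^ (N * (p * p ^ N)) + 1) ∧ ∀ i j, κ i = κ j →
      ∀ v ∈ V, ∀ a : ZMod p, ∀ ξ : Fin n → ZMod p, (∀ z ∉ Z, ξ z = 0) →
        popularValue (A i) (a • v + ξ) = popularValue (A j) (a • v + ξ) := by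
  classical
  let I := V × ZMod p × (Z → ZMod p)
  let f : ι → I → ZMod p := fun i q => popularValue (A i)
    (q.2.1 • q.1.1 + fun z => if h : z ∈ Z then q.2.2 ⟨z, h⟩ else 0)
  have hp : 1 ≤ p := (Fact.out : p.Prime).one_lt.le
  have hcard : Fintype.card (I → ZMod p) ≤ p ^ (N * (p * p ^ N)) := by
    simp only [I, Fintype.card_fun, Fintype.card_prod, Fintype.card_coe, ZMod.card]
    gcongr
  refine ⟨fun i => Fintype.equivFin (I → ZMod p) (f i), fun i => ?_, fun i j hij v hv a ξ hξ => ?_⟩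
  · exact Nat.lt_succ_of_lt ((Fintype.equivFin (I → ZMod p) (f i)).2.trans_le hcard)
  · have h1 : f i = f j := (Fintype.equivFin (I → ZMod p)).injective (Fin.ext hij)
    have h2 := congrFun h1 (⟨v, hv⟩, a, fun z => ξ z)
    have h3 : (fun z => if h : z ∈ Z then ξ z else 0) = ξ := by
      funext z
      by_cases hz : z ∈ Z
      · simp [hz]
      · simp [hz, hξ z hz]
    simpa only [f, h3] using h2

theorem exists_eq_dotProduct {p n : ℕ} (φ : ModPForm p n) :
    ∃ ψ : Fin n → ZMod p, ∀ x, φ x = ψ ⬝ᵥ x := by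
  refine ⟨fun z => φ (Pi.single z 1), fun x => ?_⟩
  rw [LinearMap.pi_apply_eq_sum_univ φ x, dotProduct]
  refine Finset.sum_congr rfl fun z _ => ?_
  rw [smul_eq_mul, mul_comm]
  congr 2
  funext j
  simp [Pi.single_apply, eq_comm]

end ModPForms

theorem mainTheorem2 (p : ℕ) [Fact p.Prime] (m : ℕ) (hm : 2 ≤ m)
    (δ ν ε : ℝ) (hδ : 0 < δ) (hν : 0 < ν) (hε : 0 < ε) :
    ∃ c : ℝ, 0 < c ∧
      ∀ (n s : ℕ), 1 ≤ n → 1 ≤ s →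
      ∀ A : Fin s → Finset (ModPForms.Cube n),
        (∀ i, (A i).Nonempty) → (∀ i, δ ≤ ModPForms.density (A i)) →
        ∃ Q : Finset (Fin s), c * (s : ℝ) ≤ (Q.card : ℝ) ∧
          (1 - ε) * (Q.card : ℝ) ^ m ≤
            (Set.ncard {i : Fin m → Fin s | (∀ t, i t ∈ Q) ∧
              ∀ φ : ModPForms.ModPForm p n,
                ((2 : ℝ) ^ ((m + 1) * (p - 1)))⁻¹ - ν ≤
                  ModPForms.formOverlap (fun t => A (i t)) φ} : ℝ) := by
  classical
  obtain ⟨γ, hγ0, hγ1, hγ⟩ := ModPForms.exists_stdAddChar_contraction p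
  obtain ⟨r, hr⟩ := exists_pow_lt_of_lt_one (by positivity : 0 < δ * ν ^ 2 / 2) hγ1
  -- The independence error is `θ` times a number of Walsh pairs bounded by `2 ^ (4 * r)`, so it
  -- stays within `ν`.
  set θ : ℝ := ν / 2 ^ (4 * r) with hθ
  have hθ0 : 0 < θ := by positivity
  obtain ⟨K₁, hK₁⟩ : ∃ K, K = ⌊2 / (δ * ν ^ 2)⌋₊ := ⟨_, rfl⟩
  obtain ⟨K₂, hK₂⟩ : ∃ K, K = K₁ * (p * (⌊1 / (δ * θ ^ 2)⌋₊ * (4 * r))) := ⟨_, rfl⟩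
  obtain ⟨K, hK⟩ : ∃ K, K = p ^ ((K₁ + K₂) * (p * p ^ (K₁ + K₂))) + 1 := ⟨_, rfl⟩
  -- Dividing `ε` by `m ^ 2` absorbs the later union bound over pairs of positions.
  obtain ⟨c, hc, hstable⟩ := ModPForms.exists_stable_subset K (K₁ + K₂) (K₁ + K₂) (ε / m ^ 2)
    (by positivity)
  refine ⟨c, hc, fun n s _ hs A hA hAδ => ?_⟩
  have hfst : ∀ (st : Finset (Fin n → ZMod p) × Finset (Fin n)) j,
      ModPForms.IsSkeleton ν θ r st (A j) → st.1.card ≤ K₁ := fun st j h => hK₁ ▸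
    h.card_fst_le hγ0 hγ1.le hγ hδ hν hr.le (hA j) (hAδ j)
  have hcoords : ∀ (V : Finset (Fin n → ZMod p)) j, V.card ≤ K₁ →
      (ModPForms.structuredCoords (A j) θ (4 * r) V).card ≤ K₂ := fun V j hV => hK₂ ▸
    (ModPForms.card_structuredCoords_le hδ hθ0 (hA j) (hAδ j) (4 * r) V).trans
      (Nat.mul_le_mul_right _ hV)
  have hsnd : ∀ (st : Finset (Fin n → ZMod p) × Finset (Fin n)) j,
      ModPForms.IsSkeleton ν θ r st (A j) → st.2.card ≤ K₂ := fun st j h =>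
    (Finset.card_le_card h.2.2).trans (hcoords st.1 j (hfst st j h))
  obtain ⟨⟨V, Z⟩, Q, hQ, hskel, hsame, hbad⟩ := hstable
    (fun st : Finset (Fin n → ZMod p) × Finset (Fin n) => st.1.card + st.2.card)
    (fun st j => ModPForms.IsSkeleton ν θ r st (A j))
    (fun st i j => ModPForms.IsLinked ν θ r st (A i) (A j))
    (fun st i j => ∀ v ∈ st.1, ∀ a : ZMod p, ∀ ξ : Fin n → ZMod p, (∀ z ∉ st.2, ξ z = 0) →
      ModPForms.popularValue (A i) (a • v + ξ) = ModPForms.popularValue (A j) (a • v + ξ))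
    (fun st j h => Nat.add_le_add (hfst st j h) (hsnd st j h))
    (fun st j h => hK ▸ ModPForms.exists_color p n (K₁ + K₂) A st.1 st.2
      ((hfst st j h).trans (Nat.le_add_right _ _)) ((hsnd st j h).trans (Nat.le_add_left _ _)))
    (fun st i h => by
      obtain ⟨O, h1, h2, h3⟩ := ModPForms.IsSkeleton.exists_extensions (θ := θ) hγ0 hγ1.le hγ hδ hν
        hr.le (hA i) (hAδ i) st
      rw [← hK₁] at h1
      exact ⟨O, h1.trans (Nat.add_le_add_left (hcoords st.1 i (hfst st i h)) _), h2,
        fun j => h3 (A j)⟩)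
    (∅, ∅) Finset.univ ⟨⟨0, hs⟩, Finset.mem_univ _⟩ (fun j _ => by simp [ModPForms.IsSkeleton])
  refine ⟨Q, by simpa using hQ, ?_⟩
  have hcount := ModPForms.card_tuples_no_bad_pair m
    (fun i j => ModPForms.IsLinked ν θ r (V, Z) (A i) (A j)) Q (ε / m ^ 2) hbad
  have hm0 : (m : ℝ) ≠ 0 := Nat.cast_ne_zero.mpr (by omega)
  rw [mul_div_cancel₀ ε (pow_ne_zero 2 hm0)] at hcount
  refine hcount.trans ?_
  rw [← Set.ncard_coe_finset]
  refine Nat.cast_le.mpr (Set.ncard_le_ncard ?_ (Set.toFinite _))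
  intro i hi
  obtain ⟨hiQ, hlink⟩ := Finset.mem_filter.mp (Finset.mem_coe.mp hi)
  have hiQ' : ∀ t, i t ∈ Q := Fintype.mem_piFinset.mp hiQ
  refine ⟨hiQ', fun φ => ?_⟩
  obtain ⟨ψ, hψ⟩ := ModPForms.exists_eq_dotProduct φ
  have h := ModPForms.overlap_ge_of_forall_not_isLinked hm (A := fun t => A (i t))
    (fun t => hA _) hθ0.le hν.le le_rfl (le_of_eq (by rw [hθ]; field_simp))
    (fun t => (hskel _ (hiQ' t)).2.2)
    (fun v hv a ξ hξ t t' => hsame _ (hiQ' t) _ (hiQ' t') v hv a ξ hξ) hlink ψ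
  simpa only [ModPForms.formOverlap, hψ] using h
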